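/- \textbf{Conventions.} A \emph{computable metric space} is a metric space $(X,d_X)$ together with a fixed dense sequence $(s_n)_{n\in\mathbb N}$ in $X$. An \emph{oracle} for a point $x\in X$ is a function $\phi:\mathbb N\to\mathbb N$ (not necessarily computable) with $d_X(x,s_{\phi(n)})<2^{-n}$ for all $n$. A map $g:X\to Y$ between computable metric spaces, with dense sequences $(s_n)$ and $(t_n)$, is \emph{computable} if there is an oracle Turing machine $\chi$ such that for every $x\in X$, every oracle $\phi$ for $x$ and every $n\in\mathbb N$, the machine halts and $d_Y(t_{\chi(\phi,n)},g(x))<2^{-n}$. The spaces $\mathbb R$ and $\mathbb R^m$ carry the Euclidean metric and a standard enumeration of $\mathbb Q$ and $\mathbb Q^m$, and $X\times X$ carries the pairs $(s_i,s_j)$. Let $f:X\to X$. Let $\mathcal M_f$ be the set of $f$-invariant Borel probability measures on $X$ with the weak$^*$ topology. For $n\ge 1$ let ${\rm Per}_n(f)$ be the set of periodic points of $f$ with smallest period $n$. For $x\in{\rm Per}_n(f)$ let $\mu_x=\frac1n\sum_{i=0}^{n-1}\delta_{f^i(x)}$, and let $\mathcal M_{\rm Per}$ be the set of all these measures $\mu_x$,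 for all $n\ge1$. The periodic points of $f$ are \emph{uniformly computable} if there is a Turing machine that on input $n\ge 1$ and $k\in\mathbb N$ outputs a finite set $\{i_1,\dots,i_\ell\}\subset\mathbb N$ with $d_H({\rm Per}_n(f),\{s_{i_1},\dots,s_{i_\ell}\})<2^{-k}$, where $d_H$ is the Hausdorff distance (with $d_H(\emptyset,\emptyset)=0$ and $d_H(\emptyset,A)=\infty$ for $A\neq\emptyset$). For $\Phi=(\Phi_1,\dots,\Phi_m):X\to\mathbb R^m$ let ${\rm Rot}(\Phi)=\left\{\left(\int\Phi_1\,d\mu,\dots,\int\Phi_m\,d\mu\right):\mu\in\mathcal M_f\right\}$. \textbf{Theorem.} Let $X$ be a compact computable metric space whose metric $d_X:X\times X\to\mathbb R$ is a computable function. Let $f:X\to X$ be a computable map such that $\mathcal M_{\rm Per}$ is dense in $\mathcal M_f$ and the periodic points of $f$ are uniformly computable, and let $\Phi:X\to\mathbb R^m$ be computable. Then there exists an oracle Turing machine that, given any oracle $\psi$ for any point $w_0\in{\rm int}\,{\rm Rot}(\Phi)$, halts and outputs a positive rational number $r$ (which may depend on $\psi$) such that the open Euclidean ball $B(w_0,r)$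 is contained in ${\rm int}\,{\rm Rot}(\Phi)$. -/

import Mathlib

open MeasureTheory

/-- Programs of oracle machines: the standard presentation of oracle Turing machines as
`μ`-recursive programs with one additional instruction that queries the oracle. -/
inductive OracleCode : Type
  | zero : OracleCode
  | succ : OracleCode
  | left : OracleCode
  | right : OracleCode
  | oracle : OracleCode
  | pair : OracleCode → OracleCode → OracleCode
  | comp : OracleCode → OracleCode → OracleCode
  | prec : OracleCode → OracleCode → OracleCode
  | rfind : OracleCode → OracleCode

namespace OracleCode

/-- `c.eval φ n` is the output of the machine `c` with oracle `φ` on input `n`; it is undefined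
if the machine does not halt. The clauses are those of Mathlib's `Nat.RecursiveIn`. -/
def eval (φ : ℕ → ℕ) : OracleCode → ℕ →. ℕ
  | zero => fun _ => Part.some 0
  | succ => fun n => Part.some (n + 1)
  | left => fun n => Part.some n.unpair.1
  | right => fun n => Part.some n.unpair.2
  | oracle => fun n => Part.some (φ n)
  | pair c d => fun n => Nat.pair <$> c.eval φ n <*> d.eval φ n
  | comp c d => fun n => d.eval φ n >>= c.eval φ
  | prec c d => fun p =>
      let (a, n) := Nat.unpair p
      n.rec (c.eval φ a) fun y IH => do
        let i ← IH
        d.eval φ (Nat.pair a (Nat.pair y i))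
  | rfind c => fun a =>
      Nat.rfind fun n => (fun m => m = 0) <$> c.eval φ (Nat.pair a n)

/-- For every fixed oracle, the functions computed by oracle machines are exactly the functions
that are partial recursive in that oracle in Mathlib's sense. -/
theorem recursiveIn_iff_exists_eval (φ : ℕ → ℕ) (f : ℕ →. ℕ) :
    Nat.RecursiveIn {(φ : ℕ →. ℕ)} f ↔ ∃ c : OracleCode, c.eval φ = f := by
  constructor
  · intro h
    induction h with
    | zero => exact ⟨zero, rfl⟩
    | succ => exact ⟨succ, rfl⟩
    | left => exact ⟨left, rfl⟩
    | right => exact ⟨right, rfl⟩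
    | oracle g hg =>
      rw [Set.mem_singleton_iff] at hg
      subst hg
      exact ⟨oracle, rfl⟩
    | pair _ _ h₁ h₂ =>
      obtain ⟨c, rfl⟩ := h₁
      obtain ⟨d, rfl⟩ := h₂
      exact ⟨pair c d, rfl⟩
    | comp _ _ h₁ h₂ =>
      obtain ⟨c, rfl⟩ := h₁
      obtain ⟨d, rfl⟩ := h₂
      exact ⟨comp c d, rfl⟩
    | prec _ _ h₁ h₂ =>
      obtain ⟨c, rfl⟩ := h₁
      obtain ⟨d, rfl⟩ := h₂
      exact ⟨prec c d, rfl⟩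
    | rfind _ h₁ =>
      obtain ⟨c, rfl⟩ := h₁
      exact ⟨rfind c, rfl⟩
  · rintro ⟨c, rfl⟩
    induction c with
    | zero => exact .zero
    | succ => exact .succ
    | left => exact .left
    | right => exact .right
    | oracle => exact .oracle _ rfl
    | pair c d hc hd => exact .pair hc hd
    | comp c d hc hd => exact .comp hc hd
    | prec c d hc hd => exact .prec hc hd
    | rfind c hc => exact .rfind hc

end OracleCode

/-- The rational number coded by a natural number: `⟨a, ⟨b, c⟩⟩` codes `(a - b) / (c + 1)`.
Every rational number has a code. -/
def ratOfCode (n : ℕ) : ℚ :=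
  ((n.unpair.1 : ℚ) - (n.unpair.2.unpair.1 : ℚ)) / ((n.unpair.2.unpair.2 : ℚ) + 1)

theorem ratOfCode_surjective : Function.Surjective ratOfCode := by
  intro q
  refine ⟨Nat.pair q.num.toNat (Nat.pair (-q.num).toNat (q.den - 1)), ?_⟩
  have h1 : ((q.den - 1 : ℕ) : ℚ) + 1 = q.den := by
    have := q.den_pos
    rw [Nat.cast_sub this]
    simp
  have h2 : ((q.num.toNat : ℕ) : ℚ) - ((-q.num).toNat : ℕ) = q.num := by
    have : ((q.num.toNat : ℕ) : ℤ) - ((-q.num).toNat : ℕ) = q.num := by omega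
    exact_mod_cast this
  simp only [ratOfCode, Nat.unpair_pair, h1, h2]
  exact q.num_div_den

/-- The point of `ℚ ^ m` coded by a natural number: the natural number codes a finite list of
natural numbers, and the `i`-th entry of the list codes the `i`-th coordinate. -/
def ratVecOfCode (m n : ℕ) (i : Fin m) : ℚ :=
  ratOfCode ((Denumerable.ofNat (List ℕ) n).getD i 0)

theorem ratVecOfCode_surjective (m : ℕ) : Function.Surjective (ratVecOfCode m) := by
  intro q
  choose k hk using fun i => ratOfCode_surjective (q i)
  refine ⟨Encodable.encode (List.ofFn k), ?_⟩
  funext i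
  simp [ratVecOfCode, hk]

/-- A computable metric space: a metric space with a fixed dense sequence. -/
class ComputableMetricSpace (X : Type*) [MetricSpace X] where
  seq : ℕ → X
  denseRange_seq : DenseRange seq

namespace ComputableMetricSpace

/-- The real line with the rational numbers. -/
noncomputable instance instReal : ComputableMetricSpace ℝ where
  seq n := (ratOfCode n : ℝ)
  denseRange_seq :=
    Rat.denseRange_cast.comp ratOfCode_surjective.denseRange Rat.continuous_coe_real

/-- Euclidean space with the rational points. -/
noncomputable instance instEuclidean (m : ℕ) :
    ComputableMetricSpace (EuclideanSpace ℝ (Fin m)) where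
  seq n := WithLp.toLp 2 fun i => (ratVecOfCode m n i : ℝ)
  denseRange_seq := by
    have h1 : DenseRange fun (q : Fin m → ℚ) (i : Fin m) => (q i : ℝ) :=
      DenseRange.piMap fun _ => Rat.denseRange_cast
    have h2 := h1.comp (ratVecOfCode_surjective m).denseRange
      (continuous_pi fun i => Rat.continuous_coe_real.comp (continuous_apply i))
    exact (WithLp.toLp_surjective 2).denseRange.comp h2 (PiLp.continuous_toLp 2 _)

/-- The product of two computable metric spaces with the pairs of members of the sequences. -/
instance instProd {X Y : Type*} [MetricSpace X] [MetricSpace Y] [ComputableMetricSpace X]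
    [ComputableMetricSpace Y] : ComputableMetricSpace (X × Y) where
  seq n := (seq n.unpair.1, seq n.unpair.2)
  denseRange_seq := by
    have h : DenseRange (Prod.map (seq : ℕ → X) (seq : ℕ → Y)) :=
      denseRange_seq.prodMap denseRange_seq
    have hs : Function.Surjective Nat.unpair := fun p => ⟨Nat.pair p.1 p.2, by simp⟩
    exact h.comp hs.denseRange continuous_of_discreteTopology

/-- `φ` is an oracle for the point `x`: `φ n` is the index of a point of the dense sequence at
distance less than `2⁻ⁿ` from `x`. The function `φ` need not be computable. -/
def IsOracle {X : Type*} [MetricSpace X] [ComputableMetricSpace X] (φ : ℕ → ℕ) (x : X) : Prop :=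
  ∀ n : ℕ, dist x (seq (φ n)) < (2 : ℝ)⁻¹ ^ n

/-- `f` is computable: one oracle machine, given any oracle for any point `x` and any precision
`n`, halts and outputs the index of a point at distance less than `2⁻ⁿ` from `f x`. -/
def IsComputableMap {X Y : Type*} [MetricSpace X] [ComputableMetricSpace X] [MetricSpace Y]
    [ComputableMetricSpace Y] (f : X → Y) : Prop :=
  ∃ c : OracleCode, ∀ (x : X) (φ : ℕ → ℕ), IsOracle φ x →
    ∀ n : ℕ, ∃ k ∈ c.eval φ n, dist (seq k) (f x) < (2 : ℝ)⁻¹ ^ n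

/-- The metric of `X` is a computable function `X × X → ℝ`. -/
def HasComputableMetric (X : Type*) [MetricSpace X] [ComputableMetricSpace X] : Prop :=
  IsComputableMap fun p : X × X => dist p.1 p.2

end ComputableMetricSpace

namespace RotationSet

open ComputableMetricSpace

/-- The set of periodic points of `f` with prime period `n`. -/
def Per {X : Type*} (f : X → X) (n : ℕ) : Set X :=
  {x | x ∈ Function.periodicPts f ∧ Function.minimalPeriod f x = n}

/-- The periodic points of `f` are uniformly computable: one Turing machine computes from `n ≥ 1`
and `k` a finite list of indices such that the Hausdorff distance between `Per f n` and the set of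
the points with these indices is less than `2⁻ᵏ`. (The extended Hausdorff distance of the empty set
to a nonempty set is infinite, so the list is empty exactly if `Per f n` is.) -/
def PeriodicPointsUniformlyComputable {X : Type*} [MetricSpace X] [ComputableMetricSpace X]
    (f : X → X) : Prop :=
  ∃ φ : ℕ → ℕ → List ℕ, Computable₂ φ ∧ ∀ n k : ℕ, 1 ≤ n →
    Metric.hausdorffEDist (Per f n) (seq '' {i | i ∈ φ n k}) < (2 : ENNReal)⁻¹ ^ k

variable {X : Type*} [MeasurableSpace X]

/-- The invariant Borel probability measures of `f`. -/
def invariantMeasures (f : X → X) : Set (ProbabilityMeasure X) :=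
  {μ | MeasurePreserving f (μ : Measure X) (μ : Measure X)}

/-- The periodic point measure `(δ_x + δ_{f x} + ⋯ + δ_{f ^ (n - 1) x}) / n` of a point `x` of
prime period `n`. -/
noncomputable def orbitMeasure (f : X → X) (x : X) : Measure X :=
  (Function.minimalPeriod f x : ENNReal)⁻¹ •
    ∑ i ∈ Finset.range (Function.minimalPeriod f x), Measure.dirac (f^[i] x)

/-- The set of all periodic point measures of `f`. -/
def periodicPointMeasures (f : X → X) : Set (ProbabilityMeasure X) :=
  {μ | ∃ x ∈ Function.periodicPts f, (μ : Measure X) = orbitMeasure f x}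

/-- The rotation vector of `μ`, the vector of the integrals of the coordinates of `Φ`. -/
noncomputable def rotationVector {m : ℕ} (Φ : X → EuclideanSpace ℝ (Fin m))
    (μ : ProbabilityMeasure X) : EuclideanSpace ℝ (Fin m) :=
  WithLp.toLp 2 fun i => ∫ x, Φ x i ∂(μ : Measure X)

/-- The rotation set of `Φ` with respect to `f`. -/
def rot {m : ℕ} (f : X → X) (Φ : X → EuclideanSpace ℝ (Fin m)) :
    Set (EuclideanSpace ℝ (Fin m)) :=
  rotationVector Φ '' invariantMeasures f

end RotationSet

/-! The machine searches for a precision `l` at which a finite certificate of interiority appears.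
It reads from the oracle an index `j` of a rational point within `2⁻ˡ` of `w₀` and tests whether
each of the `2m` points obtained by adding `±4(m+1)2⁻ˡ` to one coordinate of that point is,
coordinatewise up to `2⁻ˡ`, a rotation vector. If the test succeeds, convexity of the rotation set
(`convex_rot`, `ball_subset_of_convex`) puts the ball of radius `2·2⁻ˡ` about the rational point
inside it, hence also the ball of radius `2⁻ˡ` about `w₀`, and `2⁻ˡ` is the output. If `w₀` is
interior, then for large `l` all tested points lie in the rotation set, and the search ends.

The test need only be semidecidable. Averages of `Φ` along periodic orbits are rotation vectors, and
density of the periodic measures makes them dense among all rotation vectors, so it suffices to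
enumerate approximate orbit averages: `exists_mem_rot_of_approximatesAverage` is soundness,
`approximatesAverage_of_mem_rot` completeness.

A periodic point is known only through nearby points of the dense sequence. The link is the use
principle, `exists_mem_evalPart_restrict`: a halting run reads finitely many oracle values, and
these are valid for a whole ball of points. Thus `OutputsOnBall` certifies one output for every
point of a ball, and chains of balls certify orbit segments. Uniform computability of the periodic
points supplies initial balls that contain periodic points of the required period. -/

/-! ### Oracle machines with partial oracles, and the use principle -/

namespace OracleCode

/-- The evaluation of an oracle machine whose oracle is a partial function. -/
def evalPart (o : ℕ →. ℕ) : OracleCode → ℕ →. ℕ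
  | zero => fun _ => Part.some 0
  | succ => fun n => Part.some (n + 1)
  | left => fun n => Part.some n.unpair.1
  | right => fun n => Part.some n.unpair.2
  | oracle => o
  | pair c d => fun n => (c.evalPart o n).bind fun x => (d.evalPart o n).map (Nat.pair x)
  | comp c d => fun n => (d.evalPart o n).bind (c.evalPart o)
  | prec c d => fun p =>
      p.unpair.2.rec (c.evalPart o p.unpair.1) fun y IH =>
        IH.bind fun i => d.evalPart o (Nat.pair p.unpair.1 (Nat.pair y i))
  | rfind c => fun a =>
      Nat.rfind fun n => (c.evalPart o (Nat.pair a n)).map fun m => decide (m = 0)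

theorem evalPart_coe (φ : ℕ → ℕ) (c : OracleCode) : c.evalPart (φ : ℕ →. ℕ) = c.eval φ := by
  induction c with
  | pair c d hc hd =>
    have h : eval φ (pair c d) =
        fun n => ((c.eval φ n).map Nat.pair).bind fun g => (d.eval φ n).map g := rfl
    rw [h, ← hc, ← hd]
    funext n
    simp [evalPart]
  | comp c d hc hd =>
    have h : eval φ (comp c d) = fun n => (d.eval φ n).bind (c.eval φ) := rfl
    rw [h, ← hc, ← hd]
    rfl
  | prec c d hc hd =>
    have h : eval φ (prec c d) = fun p => p.unpair.2.rec (c.eval φ p.unpair.1) fun y IH =>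
        IH.bind fun i => d.eval φ (Nat.pair p.unpair.1 (Nat.pair y i)) := rfl
    rw [h, ← hc, ← hd]
    rfl
  | rfind c hc =>
    have h : eval φ (rfind c) = fun a =>
      Nat.rfind fun n => (c.eval φ (Nat.pair a n)).map fun m => decide (m = 0) := rfl
    rw [h, ← hc]
    rfl
  | _ => rfl

theorem mem_evalPart_pair {o : ℕ →. ℕ} {c d : OracleCode} {n v : ℕ} :
    v ∈ (pair c d).evalPart o n ↔
      ∃ x ∈ c.evalPart o n, ∃ y ∈ d.evalPart o n, Nat.pair x y = v := by
  simp [evalPart, Part.mem_bind_iff, Part.mem_map_iff]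

theorem mem_evalPart_comp {o : ℕ →. ℕ} {c d : OracleCode} {n v : ℕ} :
    v ∈ (comp c d).evalPart o n ↔ ∃ x ∈ d.evalPart o n, v ∈ c.evalPart o x :=
  Part.mem_bind_iff

theorem mem_evalPart_prec_zero {o : ℕ →. ℕ} {c d : OracleCode} {a v : ℕ} :
    v ∈ (prec c d).evalPart o (Nat.pair a 0) ↔ v ∈ c.evalPart o a := by
  simp [evalPart]

theorem mem_evalPart_prec_succ {o : ℕ →. ℕ} {c d : OracleCode} {a k v : ℕ} :
    v ∈ (prec c d).evalPart o (Nat.pair a (k + 1)) ↔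
      ∃ x ∈ (prec c d).evalPart o (Nat.pair a k),
        v ∈ d.evalPart o (Nat.pair a (Nat.pair k x)) := by
  simp only [evalPart, Nat.unpair_pair]
  exact Part.mem_bind_iff

theorem mem_evalPart_rfind {o : ℕ →. ℕ} {c : OracleCode} {a v : ℕ} :
    v ∈ (rfind c).evalPart o a ↔ 0 ∈ c.evalPart o (Nat.pair a v) ∧
      ∀ m < v, ∃ y ∈ c.evalPart o (Nat.pair a m), y ≠ 0 := by
  refine Nat.mem_rfind.trans (and_congr ?_ (forall_congr' fun m => imp_congr Iff.rfl ?_)) <;>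
  simp [Part.mem_map_iff]

/-- No clause can observe that the oracle diverges: even `rfind` requires a defined nonzero value at
every smaller argument. Further answers therefore never change an output already obtained. -/
theorem evalPart_mono {o o' : ℕ →. ℕ} (h : ∀ n, ∀ v ∈ o n, v ∈ o' n) (c : OracleCode) :
    ∀ n, ∀ v ∈ c.evalPart o n, v ∈ c.evalPart o' n := by
  induction c with
  | oracle => exact h
  | pair c d hc hd =>
    intro n v hv
    obtain ⟨x, hx, y, hy, rfl⟩ := mem_evalPart_pair.1 hv
    exact mem_evalPart_pair.2 ⟨x, hc _ _ hx, y, hd _ _ hy, rfl⟩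
  | comp c d hc hd =>
    intro n v hv
    obtain ⟨x, hx, hy⟩ := mem_evalPart_comp.1 hv
    exact mem_evalPart_comp.2 ⟨x, hd _ _ hx, hc _ _ hy⟩
  | prec c d hc hd =>
    intro p
    obtain ⟨⟨a, k⟩, rfl⟩ : ∃ q : ℕ × ℕ, p = Nat.pair q.1 q.2 := ⟨p.unpair, by simp⟩
    induction k with
    | zero =>
      intro v hv
      exact mem_evalPart_prec_zero.2 (hc _ _ (mem_evalPart_prec_zero.1 hv))
    | succ k ih =>
      intro v hv
      obtain ⟨x, hx, hy⟩ := mem_evalPart_prec_succ.1 hv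
      exact mem_evalPart_prec_succ.2 ⟨x, ih _ hx, hd _ _ hy⟩
  | rfind c hc =>
    intro a v hv
    obtain ⟨h0, hlt⟩ := mem_evalPart_rfind.1 hv
    refine mem_evalPart_rfind.2 ⟨hc _ _ h0, fun m hm => ?_⟩
    obtain ⟨y, hy, hy0⟩ := hlt m hm
    exact ⟨y, hc _ _ hy, hy0⟩
  | _ => exact fun _ _ h => h

/-- The restriction of an oracle to the queries below `L`. -/
def restrict (φ : ℕ → ℕ) (L : ℕ) : ℕ →. ℕ :=
  fun n => Part.assert (n < L) fun _ => Part.some (φ n)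

theorem mem_restrict {φ : ℕ → ℕ} {L n v : ℕ} : v ∈ restrict φ L n ↔ n < L ∧ v = φ n := by
  simp [restrict]

theorem evalPart_restrict_mono {φ : ℕ → ℕ} {L L' : ℕ} (h : L ≤ L') {c : OracleCode} {n v : ℕ}
    (hv : v ∈ c.evalPart (restrict φ L) n) : v ∈ c.evalPart (restrict φ L') n :=
  evalPart_mono (fun _ _ hw => mem_restrict.2 ⟨(mem_restrict.1 hw).1.trans_le h,
    (mem_restrict.1 hw).2⟩) c n v hv

theorem restrict_congr {φ φ' : ℕ → ℕ} {L : ℕ} (h : ∀ n < L, φ n = φ' n) :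
    restrict φ L = restrict φ' L := by
  funext n
  ext v
  simp only [mem_restrict]
  exact and_congr_right fun hn => by rw [h n hn]

theorem mem_eval_of_mem_evalPart_restrict {φ : ℕ → ℕ} {L : ℕ} {c : OracleCode} {n v : ℕ}
    (hv : v ∈ c.evalPart (restrict φ L) n) : v ∈ c.eval φ n := by
  rw [← evalPart_coe]
  exact evalPart_mono (fun _ _ hw => by simp [(mem_restrict.1 hw).2]) c n v hv

/-- A halting computation makes finitely many queries. -/
theorem exists_mem_evalPart_restrict (φ : ℕ → ℕ) (c : OracleCode) :
    ∀ n, ∀ v ∈ c.eval φ n, ∃ L, v ∈ c.evalPart (restrict φ L) n := by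
  rw [← evalPart_coe]
  induction c with
  | oracle =>
    intro n v hv
    exact ⟨n + 1, mem_restrict.2 ⟨n.lt_succ_self, by simpa [evalPart] using hv⟩⟩
  | pair c d hc hd =>
    intro n v hv
    obtain ⟨x, hx, y, hy, rfl⟩ := mem_evalPart_pair.1 hv
    obtain ⟨L, hL⟩ := hc _ _ hx
    obtain ⟨L', hL'⟩ := hd _ _ hy
    exact ⟨max L L', mem_evalPart_pair.2 ⟨x, evalPart_restrict_mono (le_max_left ..) hL, y,
      evalPart_restrict_mono (le_max_right ..) hL', rfl⟩⟩
  | comp c d hc hd =>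
    intro n v hv
    obtain ⟨x, hx, hy⟩ := mem_evalPart_comp.1 hv
    obtain ⟨L, hL⟩ := hd _ _ hx
    obtain ⟨L', hL'⟩ := hc _ _ hy
    exact ⟨max L L', mem_evalPart_comp.2 ⟨x, evalPart_restrict_mono (le_max_left ..) hL,
      evalPart_restrict_mono (le_max_right ..) hL'⟩⟩
  | prec c d hc hd =>
    intro p
    obtain ⟨⟨a, k⟩, rfl⟩ : ∃ q : ℕ × ℕ, p = Nat.pair q.1 q.2 := ⟨p.unpair, by simp⟩
    induction k with
    | zero =>
      intro v hv
      obtain ⟨L, hL⟩ := hc _ _ (mem_evalPart_prec_zero.1 hv)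
      exact ⟨L, mem_evalPart_prec_zero.2 hL⟩
    | succ k ih =>
      intro v hv
      obtain ⟨x, hx, hy⟩ := mem_evalPart_prec_succ.1 hv
      obtain ⟨L, hL⟩ := ih _ hx
      obtain ⟨L', hL'⟩ := hd _ _ hy
      exact ⟨max L L', mem_evalPart_prec_succ.2 ⟨x, evalPart_restrict_mono (le_max_left ..) hL,
        evalPart_restrict_mono (le_max_right ..) hL'⟩⟩
  | rfind c hc =>
    intro a v hv
    obtain ⟨h0, hlt⟩ := mem_evalPart_rfind.1 hv
    obtain ⟨L, hL⟩ := hc _ _ h0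
    -- The search examines finitely many candidates before `v`; induction on their number gives one
    -- query bound for all of them.
    have : ∀ k ≤ v, ∃ L', ∀ m < k, ∃ y ∈ c.evalPart (restrict φ L') (Nat.pair a m), y ≠ 0 := by
      intro k
      induction k with
      | zero => simp
      | succ k ih =>
        intro hk
        obtain ⟨L₁, h₁⟩ := ih (by omega)
        obtain ⟨y, hy, hy0⟩ := hlt k (by omega)
        obtain ⟨L₂, h₂⟩ := hc _ _ hy
        refine ⟨max L₁ L₂, fun m hm => ?_⟩
        rcases Nat.lt_succ_iff_lt_or_eq.1 hm with hm | rfl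
        · obtain ⟨w, hw, hw0⟩ := h₁ m hm
          exact ⟨w, evalPart_restrict_mono (le_max_left ..) hw, hw0⟩
        · exact ⟨y, evalPart_restrict_mono (le_max_right ..) h₂, hy0⟩
    obtain ⟨L', hL'⟩ := this v le_rfl
    refine ⟨max L L', mem_evalPart_rfind.2
      ⟨evalPart_restrict_mono (le_max_left ..) hL, fun m hm => ?_⟩⟩
    obtain ⟨w, hw, hw0⟩ := hL' m hm
    exact ⟨w, evalPart_restrict_mono (le_max_right ..) hw, hw0⟩
  | _ => exact fun _ _ h => ⟨0, h⟩

/-- Evaluation is partial recursive uniformly in a partial recursive family of oracles. -/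
theorem partrec_evalPart {β : Type*} [Primcodable β] {o : β → ℕ →. ℕ} (ho : Partrec₂ o)
    (c : OracleCode) : Partrec₂ fun b n => c.evalPart (o b) n := by
  have hpair : Computable₂ Nat.pair := Primrec₂.natPair.to_comp
  induction c with
  | zero => exact (Computable.const 0).partrec
  | succ => exact (Computable.succ.comp Computable.snd).partrec
  | left => exact (Computable.fst.comp (Computable.unpair.comp Computable.snd)).partrec
  | right => exact (Computable.snd.comp (Computable.unpair.comp Computable.snd)).partrec
  | oracle => exact ho
  | pair c d hc hd =>
    have hd' : Partrec fun a : (β × ℕ) × ℕ => d.evalPart (o a.1.1) a.1.2 :=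
      hd.comp (Computable.fst.comp Computable.fst) (Computable.snd.comp Computable.fst)
    exact Partrec.bind hc (Partrec.map hd'
      (hpair.comp (Computable.snd.comp Computable.fst) Computable.snd).to₂).to₂
  | comp c d hc hd =>
    exact Partrec.bind hd (hc.comp (Computable.fst.comp Computable.fst) Computable.snd).to₂
  | prec c d hc hd =>
    have hu : Computable fun p : β × ℕ => p.2.unpair := Computable.unpair.comp Computable.snd
    have hu' : Computable fun p : (β × ℕ) × ℕ × ℕ => p.1.2.unpair.1 :=
      Computable.fst.comp (hu.comp Computable.fst)
    exact Partrec.nat_rec (Computable.snd.comp hu)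
      (hc.comp Computable.fst (Computable.fst.comp hu))
      (hd.comp (Computable.fst.comp Computable.fst)
        (hpair.comp hu' (hpair.comp (Computable.fst.comp Computable.snd)
          (Computable.snd.comp Computable.snd)))).to₂
  | rfind c hc =>
    have h0 : Computable fun m : ℕ => decide (m = 0) :=
      (Primrec.eq.decide.comp Primrec.id (Primrec.const 0)).to_comp
    exact Partrec.rfind (Partrec.map
      (hc.comp (Computable.fst.comp Computable.fst)
        (hpair.comp (Computable.snd.comp Computable.fst) Computable.snd))
      (h0.comp Computable.snd).to₂).to₂

/-- Oracle machines compute all partial recursive functions. -/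
theorem exists_eval_eq_of_partrec {g : ℕ →. ℕ} (hg : Nat.Partrec g) :
    ∃ c : OracleCode, ∀ o, c.evalPart o = g := by
  induction hg with
  | zero => exact ⟨zero, fun _ => rfl⟩
  | succ => exact ⟨succ, fun _ => rfl⟩
  | left => exact ⟨left, fun _ => rfl⟩
  | right => exact ⟨right, fun _ => rfl⟩
  | @pair f g _ _ h₁ h₂ =>
    obtain ⟨c, hc⟩ := h₁
    obtain ⟨d, hd⟩ := h₂
    have h : (fun n => Nat.pair <$> f n <*> g n) =
        fun n => ((f n).map Nat.pair).bind fun k => (g n).map k := rfl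
    exact ⟨pair c d, fun o => by rw [h, ← hc o, ← hd o]; funext n; simp [evalPart]⟩
  | @comp f g _ _ h₁ h₂ =>
    obtain ⟨c, hc⟩ := h₁
    obtain ⟨d, hd⟩ := h₂
    exact ⟨comp c d, fun o => by rw [← hc o, ← hd o]; rfl⟩
  | prec _ _ h₁ h₂ =>
    obtain ⟨c, hc⟩ := h₁
    obtain ⟨d, hd⟩ := h₂
    exact ⟨prec c d, fun o => by rw [← hc o, ← hd o]; rfl⟩
  | rfind _ h₁ =>
    obtain ⟨c, hc⟩ := h₁
    exact ⟨rfind c, fun o => by rw [← hc o]; rfl⟩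

/-- Search with an oracle: a machine that looks for `z` such that the decidable relation `q` holds
of `z` and the oracle's answer to a query computed from `z`, and then outputs `r z`. -/
theorem exists_search {q : ℕ → ℕ → Bool} (hq : Computable₂ q) {u r : ℕ → ℕ} (hu : Computable u)
    (hr : Computable r) : ∃ c : OracleCode, ∀ ψ : ℕ → ℕ, (∃ z, q (ψ (u z)) z = true) →
      ∃ z, q (ψ (u z)) z = true ∧ r z ∈ c.eval ψ 0 := by
  obtain ⟨cu, hcu⟩ := exists_eval_eq_of_partrec (Partrec.nat_iff.1 hu.partrec)
  obtain ⟨cr, hcr⟩ := exists_eval_eq_of_partrec (Partrec.nat_iff.1 hr.partrec)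
  -- `rfind` looks for the value `0`, so truth is encoded as `0`.
  have hq' : Computable fun p : ℕ => cond (q p.unpair.1 p.unpair.2) 0 1 :=
    Computable.cond (hq.comp (Computable.fst.comp Computable.unpair)
      (Computable.snd.comp Computable.unpair)) (Computable.const 0) (Computable.const 1)
  obtain ⟨cq, hcq⟩ := exists_eval_eq_of_partrec (Partrec.nat_iff.1 hq'.partrec)
  refine ⟨comp cr (rfind (comp cq (pair (comp oracle (comp cu right)) right))), fun ψ hz => ?_⟩
  have hv : ∀ n v, v ∈ evalPart ψ (comp cq (pair (comp oracle (comp cu right)) right))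
      (Nat.pair 0 n) ↔ v = cond (q (ψ (u n)) n) 0 1 := by
    intro n v
    have hr : ∀ x, x ∈ evalPart ψ right (Nat.pair 0 n) ↔ x = n := by simp [evalPart]
    have ho : ∀ k x, x ∈ evalPart ψ oracle k ↔ x = ψ k := by simp [evalPart]
    simp [mem_evalPart_comp, mem_evalPart_pair, hr, ho, hcu, hcq]
  simp only [← evalPart_coe, mem_evalPart_comp, mem_evalPart_rfind, hv, hcr]
  refine ⟨Nat.find hz, Nat.find_spec hz, Nat.find hz, ⟨?_, fun m hm => ⟨1, ?_, one_ne_zero⟩⟩, ?_⟩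
  · simp [Nat.find_spec hz]
  · simp [Bool.eq_false_of_not_eq_true (Nat.find_min hz hm)]
  · simp

end OracleCode

/-! ### Closure properties of recursively enumerable predicates -/

section RecursivelyEnumerable

variable {α β : Type*} [Primcodable α] [Primcodable β]

/-- The finite sequence coded by a natural number, continued by zeros. -/
def seqOf (z t : ℕ) : ℕ :=
  (Denumerable.ofNat (List ℕ) z).getD t 0

theorem computable_seqOf : Computable₂ seqOf :=
  ((Primrec.list_getD 0).comp ((Primrec.ofNat (List ℕ)).comp Primrec.fst) Primrec.snd).to_comp

theorem exists_seqOf (g : ℕ → ℕ) (n : ℕ) : ∃ z, ∀ t < n, seqOf z t = g t := by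
  refine ⟨Encodable.encode ((List.range n).map g), fun t ht => ?_⟩
  simp [seqOf, ht]

/-- The graph of a partial recursive function is decidable in the number of steps. -/
theorem Partrec.exists_computable_steps {f : α →. β} (hf : Partrec f) :
    ∃ q : α → ℕ → Option β, Computable₂ q ∧ ∀ a b, b ∈ f a ↔ ∃ n, q a n = some b := by
  obtain ⟨c, hc⟩ := Nat.Partrec.Code.exists_code.1 hf
  refine ⟨fun a n => (Nat.Partrec.Code.evaln n c (Encodable.encode a)).bind Encodable.decode, ?_,
    fun a b => ?_⟩
  · exact Computable.option_bind
      (Nat.Partrec.Code.primrec_evaln.comp (Primrec.pair (Primrec.pair Primrec.snd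
        (Primrec.const c)) (Primrec.encode.comp Primrec.fst))).to_comp
      (Computable.decode.comp Computable.snd)
  · have h1 : Encodable.encode b ∈ c.eval (Encodable.encode a) ↔ b ∈ f a := by
      simp [hc]
    rw [← h1]
    constructor
    · intro h
      obtain ⟨n, hn⟩ := Nat.Partrec.Code.evaln_complete.1 h
      exact ⟨n, by rw [Option.mem_def] at hn; simp [hn]⟩
    · rintro ⟨n, hn⟩
      obtain ⟨y, hy, hyb⟩ := Option.bind_eq_some_iff.1 hn
      have h2 := Nat.Partrec.Code.evaln_sound hy
      rw [hc] at h2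
      obtain ⟨b', hb', rfl⟩ : ∃ b' ∈ f a, Encodable.encode b' = y := by simpa using h2
      simp only [Encodable.encodek, Option.some.injEq] at hyb
      subst hyb
      exact h1.2 hb'

theorem rePred_iff_exists_computable {p : α → Prop} :
    REPred p ↔ ∃ q : α → ℕ → Bool, Computable₂ q ∧ ∀ a, p a ↔ ∃ n, q a n = true := by
  constructor
  · intro h
    obtain ⟨q, hq, hqp⟩ := Partrec.exists_computable_steps h
    refine ⟨fun a n => (q a n).isSome, ?_, fun a => ?_⟩
    · exact Primrec.option_isSome.to_comp.comp hq
    · simp only [Option.isSome_iff_exists]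
      constructor
      · intro ha
        obtain ⟨n, hn⟩ := (hqp a ()).1 (by simpa using ha)
        exact ⟨n, _, hn⟩
      · rintro ⟨n, b, hb⟩
        simpa using (hqp a b).2 ⟨n, hb⟩
  · rintro ⟨q, hq, hqp⟩
    have h : Partrec fun a => Nat.rfind fun n => Part.some (q a n) := Partrec.rfind hq.partrec₂
    refine h.dom_re.of_eq fun a => ?_
    refine Nat.rfind_dom.trans ?_
    rw [hqp]
    constructor
    · rintro ⟨n, hn, -⟩
      exact ⟨n, (Part.mem_some_iff.1 hn).symm⟩
    · rintro ⟨n, hn⟩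
      exact ⟨n, Part.mem_some_iff.2 hn.symm, fun _ => trivial⟩

namespace REPred

theorem comp {p : β → Prop} (hp : REPred p) {f : α → β} (hf : Computable f) :
    REPred fun a => p (f a) :=
  Partrec.comp hp hf

protected theorem and {p p' : α → Prop} (hp : REPred p) (hp' : REPred p') :
    REPred fun a => p a ∧ p' a := by
  refine (Partrec.bind hp (Partrec.comp hp' Computable.fst).to₂).dom_re.of_eq fun a => ?_
  simp [Part.assert]

theorem exists_nat {p : α × ℕ → Prop} (hp : REPred p) : REPred fun a => ∃ n, p (a, n) := by
  obtain ⟨q, hq, hqp⟩ := rePred_iff_exists_computable.1 hp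
  refine rePred_iff_exists_computable.2 ⟨fun a n => q (a, n.unpair.1) n.unpair.2, ?_, fun a => ?_⟩
  · exact hq.comp
      (Computable.fst.pair (Computable.fst.comp (Computable.unpair.comp Computable.snd)))
      (Computable.snd.comp (Computable.unpair.comp Computable.snd))
  · simp only [hqp]
    exact ⟨fun ⟨n, k, h⟩ => ⟨Nat.pair n k, by simpa using h⟩, fun ⟨z, h⟩ => ⟨_, _, h⟩⟩

/-- One number `z` codes a witness for each of the finitely many `t`, so the bounded quantifier
moves inside a single existential one. -/
theorem forall_lt {p : α × ℕ → Prop} (hp : REPred p) {b : α → ℕ} (hb : Computable b) :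
    REPred fun a => ∀ t < b a, p (a, t) := by
  obtain ⟨q, hq, hqp⟩ := rePred_iff_exists_computable.1 hp
  have hrec : ∀ a z n, Nat.rec true (fun t r => r && q (a, t) (seqOf z t)) n = true ↔
      ∀ t < n, q (a, t) (seqOf z t) = true := by
    intro a z n
    induction n with
    | zero => simp
    | succ n ih =>
      simp only [Bool.and_eq_true, ih, Nat.lt_succ_iff_lt_or_eq, or_imp, forall_and, forall_eq]
  refine rePred_iff_exists_computable.2
    ⟨fun a z => Nat.rec true (fun t r => r && q (a, t) (seqOf z t)) (b a), ?_, fun a => ?_⟩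
  · have ht : Computable fun x : (α × ℕ) × ℕ × Bool => x.2.1 := Computable.fst.comp Computable.snd
    have hr : Computable fun x : (α × ℕ) × ℕ × Bool => x.2.2 := Computable.snd.comp Computable.snd
    have hand : Computable₂ and := Primrec.and.to_comp
    have hq' : Computable fun x : (α × ℕ) × ℕ × Bool => q (x.1.1, x.2.1) (seqOf x.1.2 x.2.1) :=
      hq.comp ((Computable.fst.comp Computable.fst).pair ht)
        (computable_seqOf.comp (Computable.snd.comp Computable.fst) ht)
    have hb' : Computable fun x : α × ℕ => b x.1 := hb.comp Computable.fst
    have hstep : Computable₂ fun (x : α × ℕ) (y : ℕ × Bool) =>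
        y.2 && q (x.1, y.1) (seqOf x.2 y.1) := (hand.comp hr hq').to₂
    exact Computable.nat_rec hb' (Computable.const true) hstep
  · simp only [hrec]
    constructor
    · intro h
      choose! g hg using fun t ht => (hqp (a, t)).1 (h t ht)
      obtain ⟨z, hz⟩ := exists_seqOf g (b a)
      exact ⟨z, fun t ht => by rw [hz t ht]; exact hg t ht⟩
    · rintro ⟨z, hz⟩ t ht
      exact (hqp _).2 ⟨_, hz t ht⟩

theorem mem_partrec [DecidableEq β] {f : α →. β} (hf : Partrec f) :
    REPred fun x : α × β => x.2 ∈ f x.1 := by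
  obtain ⟨q, hq, hqp⟩ := hf.exists_computable_steps
  refine rePred_iff_exists_computable.2 ⟨fun x n => decide (q x.1 n = some x.2), ?_, fun x => ?_⟩
  · exact Primrec.eq.decide.to_comp.comp (hq.comp (Computable.fst.comp Computable.fst)
      Computable.snd) (Computable.option_some.comp (Computable.snd.comp Computable.fst))
  · simp [hqp]

end REPred

end RecursivelyEnumerable

/-! ### Arithmetic on codes of rational numbers -/

section RationalCodes

/-- A code of the sum of two coded rational numbers. -/
def addCode (x y : ℕ) : ℕ :=
  Nat.pair (x.unpair.1 * (y.unpair.2.unpair.2 + 1) + y.unpair.1 * (x.unpair.2.unpair.2 + 1))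
    (Nat.pair (x.unpair.2.unpair.1 * (y.unpair.2.unpair.2 + 1) +
      y.unpair.2.unpair.1 * (x.unpair.2.unpair.2 + 1))
      ((x.unpair.2.unpair.2 + 1) * (y.unpair.2.unpair.2 + 1) - 1))

/-- A code of the quotient `c / d` of a natural number and a positive natural number. -/
def quotCode (c d : ℕ) : ℕ :=
  Nat.pair c (Nat.pair 0 (d - 1))

/-- A code of the product of a natural number and a coded rational number. -/
def nsmulCode (c x : ℕ) : ℕ :=
  Nat.pair (c * x.unpair.1) (Nat.pair (c * x.unpair.2.unpair.1) x.unpair.2.unpair.2)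

theorem ratOfCode_addCode (x y : ℕ) : ratOfCode (addCode x y) = ratOfCode x + ratOfCode y := by
  simp only [ratOfCode, addCode, Nat.unpair_pair]
  rw [Nat.cast_sub (by nlinarith [Nat.zero_le x.unpair.2.unpair.2])]
  push_cast
  rw [sub_add_cancel, div_add_div _ _ (by positivity) (by positivity)]
  congr 1
  ring

theorem ratOfCode_quotCode {c d : ℕ} (hd : 0 < d) : ratOfCode (quotCode c d) = c / d := by
  simp only [ratOfCode, quotCode, Nat.unpair_pair]
  rw [Nat.cast_sub hd]
  simp

theorem ratOfCode_nsmulCode (c x : ℕ) : ratOfCode (nsmulCode c x) = c * ratOfCode x := by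
  simp only [ratOfCode, nsmulCode, Nat.unpair_pair]
  push_cast
  ring

theorem ratOfCode_zero : ratOfCode 0 = 0 := by
  simp [ratOfCode]

/-- Cross-multiplication, with the negative terms moved to the other side, leaves a comparison of
natural numbers, which is primitive recursive. -/
theorem ratOfCode_lt_iff (x y : ℕ) : ratOfCode x < ratOfCode y ↔
    x.unpair.1 * (y.unpair.2.unpair.2 + 1) + y.unpair.2.unpair.1 * (x.unpair.2.unpair.2 + 1) <
    y.unpair.1 * (x.unpair.2.unpair.2 + 1) + x.unpair.2.unpair.1 * (y.unpair.2.unpair.2 + 1) := by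
  simp only [ratOfCode]
  rw [div_lt_div_iff₀ (by positivity) (by positivity)]
  rw [← Nat.cast_lt (α := ℚ)]
  push_cast
  constructor <;> intro h <;> linarith

theorem primrec_codeParts : Primrec (fun x : ℕ => x.unpair.1) ∧
    Primrec (fun x : ℕ => x.unpair.2.unpair.1) ∧ Primrec fun x : ℕ => x.unpair.2.unpair.2 + 1 :=
  have h : Primrec fun x : ℕ => x.unpair.2.unpair :=
    Primrec.unpair.comp (Primrec.snd.comp Primrec.unpair)
  ⟨Primrec.fst.comp Primrec.unpair, Primrec.fst.comp h, Primrec.succ.comp (Primrec.snd.comp h)⟩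

theorem computable_addCode : Computable₂ addCode := by
  obtain ⟨h1, h2, h3⟩ := primrec_codeParts
  have add := Primrec.nat_add
  have mul := Primrec.nat_mul
  refine Primrec.to_comp (Primrec₂.natPair.comp
    (add.comp (mul.comp (h1.comp Primrec.fst) (h3.comp Primrec.snd))
      (mul.comp (h1.comp Primrec.snd) (h3.comp Primrec.fst)))
    (Primrec₂.natPair.comp
      (add.comp (mul.comp (h2.comp Primrec.fst) (h3.comp Primrec.snd))
        (mul.comp (h2.comp Primrec.snd) (h3.comp Primrec.fst)))
      (Primrec.pred.comp (mul.comp (h3.comp Primrec.fst) (h3.comp Primrec.snd)))))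

theorem computable_quotCode : Computable₂ quotCode :=
  Primrec.to_comp (Primrec₂.natPair.comp Primrec.fst
    (Primrec₂.natPair.comp (Primrec.const 0) (Primrec.pred.comp Primrec.snd)))

theorem computable_nsmulCode : Computable₂ nsmulCode := by
  obtain ⟨h1, h2, -⟩ := primrec_codeParts
  have h3 : Primrec fun x : ℕ => x.unpair.2.unpair.2 :=
    Primrec.snd.comp (Primrec.unpair.comp (Primrec.snd.comp Primrec.unpair))
  have mul := Primrec.nat_mul
  exact Primrec.to_comp (Primrec₂.natPair.comp (mul.comp Primrec.fst (h1.comp Primrec.snd))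
    (Primrec₂.natPair.comp (mul.comp Primrec.fst (h2.comp Primrec.snd)) (h3.comp Primrec.snd)))

theorem rePred_ratOfCode_lt : REPred fun p : ℕ × ℕ => ratOfCode p.1 < ratOfCode p.2 := by
  obtain ⟨h1, h2, h3⟩ := primrec_codeParts
  have add := Primrec.nat_add
  have mul := Primrec.nat_mul
  have h : PrimrecPred fun p : ℕ × ℕ => p.1.unpair.1 * (p.2.unpair.2.unpair.2 + 1) +
      p.2.unpair.2.unpair.1 * (p.1.unpair.2.unpair.2 + 1) <
      p.2.unpair.1 * (p.1.unpair.2.unpair.2 + 1) +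
        p.1.unpair.2.unpair.1 * (p.2.unpair.2.unpair.2 + 1) :=
    Primrec.nat_lt.comp
      (add.comp (mul.comp (h1.comp Primrec.fst) (h3.comp Primrec.snd))
        (mul.comp (h2.comp Primrec.snd) (h3.comp Primrec.fst)))
      (add.comp (mul.comp (h1.comp Primrec.snd) (h3.comp Primrec.fst))
        (mul.comp (h2.comp Primrec.fst) (h3.comp Primrec.snd)))
  exact h.computablePred.to_re.of_eq fun p => (ratOfCode_lt_iff _ _).symm

/-- A code of `c * 2⁻ᵏ`. -/
def dyadicCode (c k : ℕ) : ℕ :=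
  quotCode c (2 ^ k)

theorem ratOfCode_dyadicCode (c k : ℕ) : (ratOfCode (dyadicCode c k) : ℝ) = c * (2 : ℝ)⁻¹ ^ k := by
  rw [dyadicCode, ratOfCode_quotCode (by positivity)]
  push_cast
  rw [inv_pow, div_eq_mul_inv]

theorem computable_dyadicCode : Computable₂ dyadicCode := by
  have h : Computable fun k : ℕ => 2 ^ k :=
    ((Primrec₂.unpaired'.1 Nat.Primrec.pow).comp (Primrec.const 2) Primrec.id).to_comp
  exact computable_quotCode.comp Computable.fst (h.comp Computable.snd)

/-- A code of `-c * 2⁻ᵏ`. -/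
def negDyadicCode (c k : ℕ) : ℕ :=
  Nat.pair 0 (Nat.pair c (2 ^ k - 1))

theorem ratOfCode_negDyadicCode (c k : ℕ) :
    (ratOfCode (negDyadicCode c k) : ℝ) = -(c * (2 : ℝ)⁻¹ ^ k) := by
  have h : ratOfCode (negDyadicCode c k) = -ratOfCode (dyadicCode c k) := by
    simp only [ratOfCode, negDyadicCode, dyadicCode, quotCode, Nat.unpair_pair]
    ring
  rw [h, Rat.cast_neg, ratOfCode_dyadicCode]

theorem computable_negDyadicCode : Computable₂ negDyadicCode := by
  have h : Primrec fun k : ℕ => 2 ^ k - 1 :=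
    Primrec.pred.comp ((Primrec₂.unpaired'.1 Nat.Primrec.pow).comp (Primrec.const 2) Primrec.id)
  exact (Primrec₂.natPair.comp (Primrec.const 0)
    (Primrec₂.natPair.comp Primrec.fst (h.comp Primrec.snd))).to_comp

end RationalCodes

/-! ### Certificates valid on whole balls -/

namespace ComputableMetricSpace

variable {X Y : Type*} [MetricSpace X] [ComputableMetricSpace X] [MetricSpace Y]
  [ComputableMetricSpace Y]

theorem seq_real (n : ℕ) : (seq n : ℝ) = ratOfCode n := rfl

theorem seq_natPair (a b : ℕ) : (seq (Nat.pair a b) : X × Y) = (seq a, seq b) := by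
  change (seq (Nat.pair a b).unpair.1, seq (Nat.pair a b).unpair.2) = _
  rw [Nat.unpair_pair]

theorem exists_dist_seq_lt (x : X) {ε : ℝ} (hε : 0 < ε) : ∃ i, dist x (seq i) < ε :=
  denseRange_seq.exists_dist_lt x hε

theorem exists_isOracle (x : X) : ∃ φ, IsOracle φ x := by
  choose φ hφ using fun n : ℕ => exists_dist_seq_lt x (ε := (2 : ℝ)⁻¹ ^ n) (by positivity)
  exact ⟨φ, hφ⟩

theorem exists_pow_lt {ε : ℝ} (hε : 0 < ε) : ∃ K : ℕ, ∀ k ≥ K, (2 : ℝ)⁻¹ ^ k < ε := by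
  obtain ⟨K, hK⟩ := exists_pow_lt_of_lt_one hε (by norm_num : (2 : ℝ)⁻¹ < 1)
  exact ⟨K, fun k hk => (pow_le_pow_of_le_one (by norm_num) (by norm_num) hk).trans_lt hK⟩

/-- If the metric is computable, then it is semidecidable whether the ball of radius `2⁻ᵏ` about
one member of the dense sequence lies well inside the ball of radius `2⁻ᵗ` about another. -/
theorem rePred_dist_lt (hd : HasComputableMetric X) : REPred fun p : (ℕ × ℕ) × ℕ × ℕ =>
    dist (seq p.1.1 : X) (seq p.1.2) + (2 : ℝ)⁻¹ ^ p.2.1 < (2 : ℝ)⁻¹ ^ p.2.2 := by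
  obtain ⟨c, hc⟩ := hd
  have ho : Computable₂ fun (p : ℕ × ℕ) (_ : ℕ) => Nat.pair p.1 p.2 :=
    Primrec₂.natPair.to_comp.comp (Computable.fst.comp Computable.fst)
      (Computable.snd.comp Computable.fst)
  have hmem : REPred fun x : (((ℕ × ℕ) × ℕ × ℕ) × ℕ) × ℕ =>
      x.2 ∈ c.evalPart (fun _ => Part.some (Nat.pair x.1.1.1.1 x.1.1.1.2)) x.1.2 :=
    REPred.comp (REPred.mem_partrec (OracleCode.partrec_evalPart ho.partrec₂ c))
      (f := fun x : (((ℕ × ℕ) × ℕ × ℕ) × ℕ) × ℕ => ((x.1.1.1, x.1.2), x.2))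
      (((Computable.fst.comp (Computable.fst.comp Computable.fst)).pair
        (Computable.snd.comp Computable.fst)).pair Computable.snd)
  have hlt : REPred fun x : (((ℕ × ℕ) × ℕ × ℕ) × ℕ) × ℕ =>
      ratOfCode (addCode x.2 (addCode (dyadicCode 1 x.1.2) (dyadicCode 1 x.1.1.2.1))) <
        ratOfCode (dyadicCode 1 x.1.1.2.2) := by
    have h2 : Computable fun x : (((ℕ × ℕ) × ℕ × ℕ) × ℕ) × ℕ => x.1.1.2 :=
      Computable.snd.comp (Computable.fst.comp Computable.fst)
    refine REPred.comp rePred_ratOfCode_lt (f := fun x : (((ℕ × ℕ) × ℕ × ℕ) × ℕ) × ℕ =>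
      (addCode x.2 (addCode (dyadicCode 1 x.1.2) (dyadicCode 1 x.1.1.2.1)),
        dyadicCode 1 x.1.1.2.2)) (Computable.pair ?_ ?_)
    · exact computable_addCode.comp Computable.snd (computable_addCode.comp
        (computable_dyadicCode.comp (Computable.const 1) (Computable.snd.comp Computable.fst))
        (computable_dyadicCode.comp (Computable.const 1) (Computable.fst.comp h2)))
    · exact computable_dyadicCode.comp (Computable.const 1) (Computable.snd.comp h2)
  refine ((hmem.and hlt).exists_nat.exists_nat).of_eq ?_
  rintro ⟨⟨a, b⟩, k, t⟩
  -- A pair of members of the dense sequence has a constant oracle, so the machine for the metric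
  -- can be run on it effectively.
  have horacle : IsOracle (fun _ => Nat.pair a b) ((seq a, seq b) : X × X) := by
    intro n
    rw [seq_natPair, dist_self]
    positivity
  have heval : ∀ q, c.evalPart (fun _ => Part.some (Nat.pair a b)) q =
      c.eval (fun _ => Nat.pair a b) q := fun q => by rw [← OracleCode.evalPart_coe]; rfl
  have hiff : ∀ e q, ratOfCode (addCode e (addCode (dyadicCode 1 q) (dyadicCode 1 k))) <
      ratOfCode (dyadicCode 1 t) ↔
      (seq e : ℝ) + ((2 : ℝ)⁻¹ ^ q + (2 : ℝ)⁻¹ ^ k) < (2 : ℝ)⁻¹ ^ t := by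
    intro e q
    rw [← Rat.cast_lt (K := ℝ), ratOfCode_addCode, ratOfCode_addCode, Rat.cast_add, Rat.cast_add,
      ratOfCode_dyadicCode, ratOfCode_dyadicCode, ratOfCode_dyadicCode]
    simp [seq_real]
  simp only [heval, hiff]
  constructor
  · rintro ⟨q, e, he, hlt⟩
    obtain ⟨e', he', hdist⟩ := hc _ _ horacle q
    obtain rfl := Part.mem_unique he he'
    have := (abs_lt.1 hdist).1
    simp only at this
    linarith
  · intro h
    obtain ⟨q, hq⟩ := exists_pow_lt (half_pos (sub_pos.2 h))
    obtain ⟨e, he, hdist⟩ := hc _ _ horacle q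
    refine ⟨q, e, he, ?_⟩
    have h1 := (abs_lt.1 hdist).2
    have h2 := hq q le_rfl
    simp only at h1
    linarith

variable (X) in
/-- With any oracle for any point of the ball of radius `2⁻ᵏ` about the `i`-th member of the dense
sequence whose first values are as in some list, the machine `c` outputs `e` on input `l`. -/
def OutputsOnBall (c : OracleCode) (i k e l : ℕ) : Prop :=
  ∃ z L, (∀ t < L, dist (seq i : X) (seq (seqOf z t)) + (2 : ℝ)⁻¹ ^ k < (2 : ℝ)⁻¹ ^ t) ∧
    e ∈ c.evalPart (OracleCode.restrict (seqOf z) L) l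

theorem rePred_outputsOnBall (hd : HasComputableMetric X) (c : OracleCode) :
    REPred fun p : (ℕ × ℕ) × ℕ × ℕ => OutputsOnBall X c p.1.1 p.1.2 p.2.1 p.2.2 := by
  have h1 : Computable fun x : (((ℕ × ℕ) × ℕ × ℕ) × ℕ) × ℕ => x.1.1.1 :=
    Computable.fst.comp (Computable.fst.comp Computable.fst)
  have h2 : Computable fun x : (((ℕ × ℕ) × ℕ × ℕ) × ℕ) × ℕ => x.1.1.2 :=
    Computable.snd.comp (Computable.fst.comp Computable.fst)
  have hz : Computable fun x : (((ℕ × ℕ) × ℕ × ℕ) × ℕ) × ℕ => x.1.2 :=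
    Computable.snd.comp Computable.fst
  have hdist : REPred fun y : ((((ℕ × ℕ) × ℕ × ℕ) × ℕ) × ℕ) × ℕ =>
      dist (seq y.1.1.1.1.1 : X) (seq (seqOf y.1.1.2 y.2)) + (2 : ℝ)⁻¹ ^ y.1.1.1.1.2 <
        (2 : ℝ)⁻¹ ^ y.2 :=
    REPred.comp (rePred_dist_lt hd) (f := fun y : ((((ℕ × ℕ) × ℕ × ℕ) × ℕ) × ℕ) × ℕ =>
        ((y.1.1.1.1.1, seqOf y.1.1.2 y.2), y.1.1.1.1.2, y.2))
      (((Computable.fst.comp (h1.comp Computable.fst)).pair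
        (computable_seqOf.comp (hz.comp Computable.fst) Computable.snd)).pair
        ((Computable.snd.comp (h1.comp Computable.fst)).pair Computable.snd))
  have ho : Partrec₂ fun p : ℕ × ℕ => OracleCode.restrict (seqOf p.1) p.2 := by
    have hb : Computable fun x : (ℕ × ℕ) × ℕ => decide (x.2 < x.1.2) :=
      (Primrec.nat_lt.comp Primrec.snd (Primrec.snd.comp Primrec.fst)).decide.to_comp
    have hs : Computable fun x : (ℕ × ℕ) × ℕ => seqOf x.1.1 x.2 :=
      computable_seqOf.comp (Computable.fst.comp Computable.fst) Computable.snd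
    refine (Partrec.cond hb hs.partrec Partrec.none).of_eq fun x => ?_
    ext v
    by_cases h : x.2 < x.1.2 <;> simp [h, OracleCode.mem_restrict]
  have hmem : REPred fun x : (((ℕ × ℕ) × ℕ × ℕ) × ℕ) × ℕ =>
      x.1.1.2.1 ∈ c.evalPart (OracleCode.restrict (seqOf x.1.2) x.2) x.1.1.2.2 :=
    REPred.comp (REPred.mem_partrec (OracleCode.partrec_evalPart ho c))
      (f := fun x : (((ℕ × ℕ) × ℕ × ℕ) × ℕ) × ℕ => (((x.1.2, x.2), x.1.1.2.2), x.1.1.2.1))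
      (((hz.pair Computable.snd).pair (Computable.snd.comp h2)).pair (Computable.fst.comp h2))
  exact ((hdist.forall_lt Computable.snd).and hmem).exists_nat.exists_nat

/-- `c` computes `g`. -/
def Computes (c : OracleCode) (g : X → Y) : Prop :=
  ∀ (x : X) (φ : ℕ → ℕ), IsOracle φ x →
    ∀ n : ℕ, ∃ k ∈ c.eval φ n, dist (seq k) (g x) < (2 : ℝ)⁻¹ ^ n

/-- The certified prefix `z` approximates every point of the ball. Spliced onto any oracle for `x`
it gives another oracle for `x`, on which the machine must output `e`. -/
theorem OutputsOnBall.dist_lt {c : OracleCode} {g : X → Y} (hc : Computes c g) {i k e l : ℕ}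
    (h : OutputsOnBall X c i k e l) {x : X} (hx : dist x (seq i) < (2 : ℝ)⁻¹ ^ k) :
    dist (seq e) (g x) < (2 : ℝ)⁻¹ ^ l := by
  obtain ⟨z, L, hz, he⟩ := h
  obtain ⟨φ, hφ⟩ := exists_isOracle x
  have hφ' : IsOracle (fun t => if t < L then seqOf z t else φ t) x := by
    intro t
    by_cases ht : t < L
    · simp only [ht, if_true]
      linarith [dist_triangle x (seq i) (seq (seqOf z t)), hz t ht]
    · simp only [ht, if_false]
      exact hφ t
  rw [OracleCode.restrict_congr
    (φ' := fun t => if t < L then seqOf z t else φ t) fun t ht => by simp [ht]] at he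
  obtain ⟨e', he', hdist⟩ := hc x _ hφ' l
  rwa [Part.mem_unique (OracleCode.mem_eval_of_mem_evalPart_restrict he) he']

/-- The oracle inequalities are strict, so each of the finitely many values read leaves some slack;
a ball smaller than half of every slack is certified. The threshold `K` does not depend on the
centre `i`, since the approximating lists do not let the centre be chosen. -/
theorem exists_outputsOnBall {c : OracleCode} {g : X → Y} (hc : Computes c g) (x : X) (l : ℕ) :
    ∃ e K, ∀ k ≥ K, ∀ i, dist x (seq i) < (2 : ℝ)⁻¹ ^ k → OutputsOnBall X c i k e l := by
  obtain ⟨φ, hφ⟩ := exists_isOracle x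
  obtain ⟨e, he, -⟩ := hc x φ hφ l
  obtain ⟨L, hL⟩ := OracleCode.exists_mem_evalPart_restrict φ c l e he
  obtain ⟨z, hz⟩ := exists_seqOf φ L
  choose K hK using fun t => exists_pow_lt (half_pos (sub_pos.2 (hφ t)))
  refine ⟨e, (Finset.range L).sup K, fun k hk i hi => ⟨z, L, fun t ht => ?_, ?_⟩⟩
  · rw [hz t ht]
    have h1 := hK t k ((Finset.le_sup (Finset.mem_range.2 ht)).trans hk)
    have h2 := dist_triangle_left (seq i) (seq (φ t)) x
    linarith
  · rwa [OracleCode.restrict_congr hz]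

/-- On a certified ball about a nearby centre all values of `g` are close to the same output `seq
e`. -/
theorem Computes.continuous {c : OracleCode} {g : X → Y} (hc : Computes c g) : Continuous g := by
  rw [Metric.continuous_iff]
  intro x ε hε
  obtain ⟨l, hl⟩ := exists_pow_lt (half_pos hε)
  obtain ⟨e, K, hK⟩ := exists_outputsOnBall hc x l
  obtain ⟨i, hi⟩ := exists_dist_seq_lt x (ε := (2 : ℝ)⁻¹ ^ K) (by positivity)
  have hb := hK K le_rfl i hi
  refine ⟨(2 : ℝ)⁻¹ ^ K - dist x (seq i), sub_pos.2 hi, fun y hy => ?_⟩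
  have hy' := hb.dist_lt hc (x := y) (by linarith [dist_triangle y x (seq i)])
  have hx' := hb.dist_lt hc hi
  have := dist_triangle_left (g y) (g x) (seq e)
  linarith [hl l le_rfl]

variable (X) in
/-- A semidecidable certificate that a map computed by `c` maps one ball into another. -/
def MapsBall (c : OracleCode) (i k j l : ℕ) : Prop :=
  ∃ e q, OutputsOnBall X c i k e q ∧ dist (seq e : X) (seq j) + (2 : ℝ)⁻¹ ^ q < (2 : ℝ)⁻¹ ^ l

theorem rePred_mapsBall (hd : HasComputableMetric X) (c : OracleCode) :
    REPred fun p : (ℕ × ℕ) × ℕ × ℕ => MapsBall X c p.1.1 p.1.2 p.2.1 p.2.2 := by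
  have h1 : Computable fun x : (((ℕ × ℕ) × ℕ × ℕ) × ℕ) × ℕ => x.1.1.1 :=
    Computable.fst.comp (Computable.fst.comp Computable.fst)
  have h2 : Computable fun x : (((ℕ × ℕ) × ℕ × ℕ) × ℕ) × ℕ => x.1.1.2 :=
    Computable.snd.comp (Computable.fst.comp Computable.fst)
  have he : Computable fun x : (((ℕ × ℕ) × ℕ × ℕ) × ℕ) × ℕ => x.1.2 :=
    Computable.snd.comp Computable.fst
  have ho := REPred.comp (rePred_outputsOnBall hd c)
    (f := fun x : (((ℕ × ℕ) × ℕ × ℕ) × ℕ) × ℕ => (x.1.1.1, x.1.2, x.2))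
    (h1.pair (he.pair Computable.snd))
  have hdist := REPred.comp (rePred_dist_lt hd)
    (f := fun x : (((ℕ × ℕ) × ℕ × ℕ) × ℕ) × ℕ => ((x.1.2, x.1.1.2.1), x.2, x.1.1.2.2))
    ((he.pair (Computable.fst.comp h2)).pair (Computable.snd.pair (Computable.snd.comp h2)))
  exact (ho.and hdist).exists_nat.exists_nat

theorem MapsBall.dist_lt {c : OracleCode} {f : X → X} (hc : Computes c f) {i k j l : ℕ}
    (h : MapsBall X c i k j l) {x : X} (hx : dist x (seq i) < (2 : ℝ)⁻¹ ^ k) :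
    dist (f x) (seq j) < (2 : ℝ)⁻¹ ^ l := by
  obtain ⟨e, q, he, hlt⟩ := h
  linarith [he.dist_lt hc hx, dist_triangle_left (f x) (seq j) (seq e : X)]

/-- The target inequality is strict: computing `f x` to within less than half of its slack makes the
semidecidable condition true. -/
theorem exists_mapsBall {c : OracleCode} {f : X → X} (hc : Computes c f) {x : X} {j l : ℕ}
    (h : dist (f x) (seq j) < (2 : ℝ)⁻¹ ^ l) :
    ∃ K, ∀ k ≥ K, ∀ i, dist x (seq i) < (2 : ℝ)⁻¹ ^ k → MapsBall X c i k j l := by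
  obtain ⟨q, hq⟩ := exists_pow_lt (half_pos (sub_pos.2 h))
  obtain ⟨e, K, hK⟩ := exists_outputsOnBall hc x q
  refine ⟨K, fun k hk i hi => ⟨e, q, hK k hk i hi, ?_⟩⟩
  have h1 := (hK k hk i hi).dist_lt hc hi
  linarith [hq q le_rfl, dist_triangle (seq e) (f x) (seq j)]

end ComputableMetricSpace

/-! ### Certified orbit segments and orbit averages -/

namespace ComputableMetricSpace

section Orbits

variable {X Y : Type*} [MetricSpace X] [ComputableMetricSpace X] [MetricSpace Y]
  [ComputableMetricSpace Y] {cf cg : OracleCode} {f : X → X} {g : X → Y}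

variable (X) in
/-- The balls of radii `2 ^ (-K t)` about the points `seq (I t)` contain orbit segments of length
`n`, as certified by `cf`, and `cg` outputs `J t` with precision `l` on the `t`-th of them. -/
def IsItinerary (cf cg : OracleCode) (I K J : ℕ → ℕ) (n l : ℕ) : Prop :=
  ∀ t < n, MapsBall X cf (I t) (K t) (I (t + 1)) (K (t + 1)) ∧
    OutputsOnBall X cg (I t) (K t) (J t) l

theorem IsItinerary.congr {I K J I' K' J' : ℕ → ℕ} {n l : ℕ} (h : IsItinerary X cf cg I K J n l)
    (hI : ∀ t < n + 1, I' t = I t) (hK : ∀ t < n + 1, K' t = K t) (hJ : ∀ t < n, J' t = J t) :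
    IsItinerary X cf cg I' K' J' n l := by
  intro t ht
  rw [hI t (by omega), hK t (by omega), hI (t + 1) (by omega), hK (t + 1) (by omega), hJ t ht]
  exact h t ht

theorem IsItinerary.dist_lt (hf : Computes cf f) (hg : Computes cg g) {I K J : ℕ → ℕ} {n l : ℕ}
    (h : IsItinerary X cf cg I K J n l) {x : X} (hx : dist x (seq (I 0)) < (2 : ℝ)⁻¹ ^ K 0) :
    ∀ t < n, dist (seq (J t)) (g (f^[t] x)) < (2 : ℝ)⁻¹ ^ l := by
  have key : ∀ t ≤ n, dist (f^[t] x) (seq (I t)) < (2 : ℝ)⁻¹ ^ K t := by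
    intro t
    induction t with
    | zero => exact fun _ => hx
    | succ t ih =>
      intro ht
      rw [Function.iterate_succ_apply']
      exact (h t ht).1.dist_lt hf (ih (by omega))
  exact fun t ht => (h t ht).2.dist_lt hg (key t ht.le)

/-- The chain is built backwards: the induction hypothesis at `f x` fixes how small the second ball
must be, and then the first ball is shrunk to be mapped into it. The output sequence `J` and the
threshold are fixed before the first centre, which comes from a list that depends on the radius. -/
theorem exists_isItinerary (hf : Computes cf f) (hg : Computes cg g) (n l : ℕ) (x : X) :
    ∃ J K₀, ∀ k ≥ K₀, ∀ i, dist x (seq i) < (2 : ℝ)⁻¹ ^ k →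
      ∃ I K : ℕ → ℕ, I 0 = i ∧ K 0 = k ∧ IsItinerary X cf cg I K J n l := by
  induction n generalizing x with
  | zero => exact ⟨id, 0, fun k _ i _ => ⟨fun _ => i, fun _ => k, rfl, rfl, by simp [IsItinerary]⟩⟩
  | succ n ih =>
    obtain ⟨J, K₀, hJ⟩ := ih (f x)
    obtain ⟨i', hi'⟩ := exists_dist_seq_lt (f x) (ε := (2 : ℝ)⁻¹ ^ K₀) (by positivity)
    obtain ⟨I, K, hI0, hK0, hIK⟩ := hJ K₀ le_rfl i' hi'
    obtain ⟨K₁, hK₁⟩ := exists_mapsBall hf hi'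
    obtain ⟨e, K₂, hK₂⟩ := exists_outputsOnBall hg x l
    refine ⟨fun t => Nat.casesOn t e J, max K₁ K₂, fun k hk i hi =>
      ⟨fun t => Nat.casesOn t i I, fun t => Nat.casesOn t k K, rfl, rfl, fun t ht => ?_⟩⟩
    cases t with
    | zero =>
      refine ⟨?_, hK₂ k ((le_max_right ..).trans hk) i hi⟩
      simp only [hI0, hK0]
      exact hK₁ k ((le_max_left ..).trans hk) i hi
    | succ t => exact hIK t (by omega)

variable (X) in
/-- A semidecidable certificate that some point of the set whose `n`-th approximations are
`φ n` has an orbit of length `n` along which the values of the map computed by `cg` are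
the points coded by `zJ`, up to `2⁻ˡ`. -/
def ApproximatesOrbit (cf cg : OracleCode) (φ : ℕ → ℕ → List ℕ) (n zJ l : ℕ) : Prop :=
  ∃ zI zK, seqOf zI 0 ∈ φ n (seqOf zK 0) ∧
    IsItinerary X cf cg (seqOf zI) (seqOf zK) (seqOf zJ) n l

theorem rePred_approximatesOrbit (hd : HasComputableMetric X) (cf cg : OracleCode)
    {φ : ℕ → ℕ → List ℕ} (hφ : Computable₂ φ) :
    REPred fun p : ℕ × ℕ × ℕ => ApproximatesOrbit X cf cg φ p.1 p.2.1 p.2.2 := by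
  have hmem : REPred fun x : (ℕ × ℕ) × ℕ => x.2 ∈ φ x.1.1 x.1.2 := by
    have h : Computable fun x : ((ℕ × ℕ) × ℕ) × ℕ =>
        decide ((φ x.1.1.1 x.1.1.2)[x.2]? = some x.1.2) :=
      Primrec.eq.decide.to_comp.comp
        (Computable.list_getElem?.comp
          (hφ.comp (Computable.fst.comp (Computable.fst.comp Computable.fst))
            (Computable.snd.comp (Computable.fst.comp Computable.fst))) Computable.snd)
        (Computable.option_some.comp (Computable.snd.comp Computable.fst))
    refine h.computablePred.to_re.exists_nat.of_eq fun x => ?_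
    rw [List.mem_iff_getElem?]
  have hI : Computable fun x : ((ℕ × ℕ × ℕ) × ℕ) × ℕ => x.1.2 := Computable.snd.comp Computable.fst
  have hK : Computable fun x : ((ℕ × ℕ × ℕ) × ℕ) × ℕ => x.2 := Computable.snd
  have hn : Computable fun x : ((ℕ × ℕ × ℕ) × ℕ) × ℕ => x.1.1.1 :=
    Computable.fst.comp (Computable.fst.comp Computable.fst)
  have hJl : Computable fun x : ((ℕ × ℕ × ℕ) × ℕ) × ℕ => x.1.1.2 :=
    Computable.snd.comp (Computable.fst.comp Computable.fst)
  have h1 : REPred fun x : ((ℕ × ℕ × ℕ) × ℕ) × ℕ => seqOf x.1.2 0 ∈ φ x.1.1.1 (seqOf x.2 0) :=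
    hmem.comp (f := fun x : ((ℕ × ℕ × ℕ) × ℕ) × ℕ => ((x.1.1.1, seqOf x.2 0), seqOf x.1.2 0))
      ((hn.pair (computable_seqOf.comp hK (Computable.const 0))).pair
        (computable_seqOf.comp hI (Computable.const 0)))
  have ht : Computable fun y : (((ℕ × ℕ × ℕ) × ℕ) × ℕ) × ℕ => y.2 := Computable.snd
  have hIt := computable_seqOf.comp (hI.comp Computable.fst) ht
  have hKt := computable_seqOf.comp (hK.comp Computable.fst) ht
  have hIt' := computable_seqOf.comp (hI.comp Computable.fst) (Computable.succ.comp ht)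
  have hKt' := computable_seqOf.comp (hK.comp Computable.fst) (Computable.succ.comp ht)
  have hJt := computable_seqOf.comp (Computable.fst.comp (hJl.comp Computable.fst)) ht
  have h2 := (rePred_mapsBall hd cf).comp ((hIt.pair hKt).pair (hIt'.pair hKt'))
  have h3 := (rePred_outputsOnBall hd cg).comp
    ((hIt.pair hKt).pair (hJt.pair (Computable.snd.comp (hJl.comp Computable.fst))))
  exact (h1.and ((h2.and h3).forall_lt hn)).exists_nat.exists_nat

/-- The dense sequence approximates the sets `P n` by the lists `φ n k` of indices. -/
def ApproximatesSets (φ : ℕ → ℕ → List ℕ) (P : ℕ → Set X) : Prop :=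
  ∀ n k : ℕ, 1 ≤ n → Metric.hausdorffEDist (P n) (seq '' {i | i ∈ φ n k}) < (2 : ENNReal)⁻¹ ^ k

theorem edist_lt_pow_iff {Z : Type*} [MetricSpace Z] {x y : Z} {k : ℕ} :
    edist x y < (2 : ENNReal)⁻¹ ^ k ↔ dist x y < (2 : ℝ)⁻¹ ^ k := by
  have h : (2 : ENNReal)⁻¹ ^ k = ENNReal.ofReal ((2 : ℝ)⁻¹ ^ k) := by
    rw [ENNReal.ofReal_pow (by norm_num), ENNReal.ofReal_inv_of_pos (by norm_num)]
    norm_num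
  rw [h, edist_dist, ENNReal.ofReal_lt_ofReal_iff (by positivity)]

/-- The first centre belongs to the list of precision `2 ^ (-K 0)`, exactly the radius of the first
ball, so that ball contains a point of `P n`; the itinerary applies to every point of the ball. -/
theorem ApproximatesOrbit.exists_mem (hf : Computes cf f) (hg : Computes cg g)
    {φ : ℕ → ℕ → List ℕ} {P : ℕ → Set X} (hP : ApproximatesSets φ P) {n zJ l : ℕ} (hn : 1 ≤ n)
    (h : ApproximatesOrbit X cf cg φ n zJ l) :
    ∃ x ∈ P n, ∀ t < n, dist (seq (seqOf zJ t)) (g (f^[t] x)) < (2 : ℝ)⁻¹ ^ l := by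
  obtain ⟨zI, zK, hmem, hit⟩ := h
  have hP' := hP n (seqOf zK 0) hn
  rw [Metric.hausdorffEDist_comm] at hP'
  obtain ⟨x, hx, hdist⟩ := Metric.exists_edist_lt_of_hausdorffEDist_lt
    (Set.mem_image_of_mem seq hmem) hP'
  rw [edist_comm, edist_lt_pow_iff] at hdist
  exact ⟨x, hx, hit.dist_lt hf hg hdist⟩

theorem exists_approximatesOrbit (hf : Computes cf f) (hg : Computes cg g)
    {φ : ℕ → ℕ → List ℕ} {P : ℕ → Set X} (hP : ApproximatesSets φ P) {n : ℕ} (hn : 1 ≤ n) {x : X}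
    (hx : x ∈ P n) (l : ℕ) : ∃ zJ, ApproximatesOrbit X cf cg φ n zJ l ∧
      ∀ t < n, dist (seq (seqOf zJ t)) (g (f^[t] x)) < (2 : ℝ)⁻¹ ^ l := by
  obtain ⟨J, K₀, hJ⟩ := exists_isItinerary hf hg n l x
  obtain ⟨_, ⟨i, hi, rfl⟩, hdist⟩ :=
    Metric.exists_edist_lt_of_hausdorffEDist_lt hx (hP n K₀ hn)
  rw [edist_lt_pow_iff] at hdist
  -- The radius `2 ^ (-K₀)` is chosen first; any listed centre that close to `x` starts an
  -- itinerary.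
  obtain ⟨I, K, rfl, rfl, hIK⟩ := hJ K₀ le_rfl i hdist
  obtain ⟨zI, hzI⟩ := exists_seqOf I (n + 1)
  obtain ⟨zK, hzK⟩ := exists_seqOf K (n + 1)
  obtain ⟨zJ, hzJ⟩ := exists_seqOf J n
  refine ⟨zJ, ⟨zI, zK, ?_, hIK.congr hzI hzK hzJ⟩, fun t ht => ?_⟩
  · rwa [hzI 0 (by omega), hzK 0 (by omega)]
  · rw [hzJ t ht]
    exact hIK.dist_lt hf hg hdist t ht

end Orbits

section Averages

variable {X : Type*} [MetricSpace X] [ComputableMetricSpace X] {cf cg : OracleCode}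
  {φ : ℕ → ℕ → List ℕ} {m : ℕ}

/-- A code of the sum of the `a`-th coordinates of the first `n` points coded by `z`. -/
def sumCode (z a n : ℕ) : ℕ :=
  Nat.rec 0 (fun t s => addCode s (seqOf (seqOf z t) a)) n

theorem ratOfCode_sumCode (z a n : ℕ) :
    ratOfCode (sumCode z a n) = ∑ t ∈ Finset.range n, ratOfCode (seqOf (seqOf z t) a) := by
  induction n with
  | zero => simp [sumCode, ratOfCode_zero]
  | succ n ih =>
    rw [Finset.sum_range_succ, ← ih, ← ratOfCode_addCode]
    rfl

theorem computable_sumCode {α : Type*} [Primcodable α] {z a n : α → ℕ} (hz : Computable z)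
    (ha : Computable a) (hn : Computable n) : Computable fun x => sumCode (z x) (a x) (n x) := by
  refine Computable.nat_rec (h := fun x y => addCode y.2 (seqOf (seqOf (z x) y.1) (a x))) hn
    (Computable.const 0) ?_
  exact (computable_addCode.comp (Computable.snd.comp Computable.snd)
    (computable_seqOf.comp (computable_seqOf.comp (hz.comp Computable.fst)
      (Computable.fst.comp Computable.snd)) (ha.comp Computable.fst))).to₂

theorem seq_euclidean_apply (n : ℕ) (a : Fin m) :
    (seq n : EuclideanSpace ℝ (Fin m)) a = ratOfCode (seqOf n a) := rfl

variable (X) in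
/-- A semidecidable certificate that, up to `2⁻ˡ`, the point coded by `j` is the average along
the orbit of some point of one of the approximated sets. -/
def ApproximatesAverage (cf cg : OracleCode) (φ : ℕ → ℕ → List ℕ) (m j l : ℕ) : Prop :=
  ∃ n z, ApproximatesOrbit X cf cg φ (n + 1) z (l + 2) ∧ ∀ a < m,
    ratOfCode (sumCode z a (n + 1)) <
      ratOfCode (nsmulCode (n + 1) (addCode (seqOf j a) (dyadicCode 1 (l + 1)))) ∧
    ratOfCode (nsmulCode (n + 1) (seqOf j a)) <
      ratOfCode (addCode (sumCode z a (n + 1)) (nsmulCode (n + 1) (dyadicCode 1 (l + 1))))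

theorem rePred_approximatesAverage (hd : HasComputableMetric X) (cf cg : OracleCode)
    (hφ : Computable₂ φ) (m : ℕ) :
    REPred fun p : ℕ × ℕ => ApproximatesAverage X cf cg φ m p.1 p.2 := by
  have hj : Computable fun x : ((ℕ × ℕ) × ℕ) × ℕ => x.1.1.1 :=
    Computable.fst.comp (Computable.fst.comp Computable.fst)
  have hl : Computable fun x : ((ℕ × ℕ) × ℕ) × ℕ => x.1.1.2 :=
    Computable.snd.comp (Computable.fst.comp Computable.fst)
  have hn : Computable fun x : ((ℕ × ℕ) × ℕ) × ℕ => x.1.2 + 1 :=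
    Computable.succ.comp (Computable.snd.comp Computable.fst)
  have hz : Computable fun x : ((ℕ × ℕ) × ℕ) × ℕ => x.2 := Computable.snd
  have h1 : REPred fun x : ((ℕ × ℕ) × ℕ) × ℕ =>
      ApproximatesOrbit X cf cg φ (x.1.2 + 1) x.2 (x.1.1.2 + 2) :=
    (rePred_approximatesOrbit hd cf cg hφ).comp
      (f := fun x : ((ℕ × ℕ) × ℕ) × ℕ => (x.1.2 + 1, x.2, x.1.1.2 + 2))
      (hn.pair (hz.pair (Computable.succ.comp (Computable.succ.comp hl))))
  have ha : Computable fun y : (((ℕ × ℕ) × ℕ) × ℕ) × ℕ => y.2 := Computable.snd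
  have hn' : Computable fun y : (((ℕ × ℕ) × ℕ) × ℕ) × ℕ => y.1.1.2 + 1 := hn.comp Computable.fst
  have hsum : Computable fun y : (((ℕ × ℕ) × ℕ) × ℕ) × ℕ => sumCode y.1.2 y.2 (y.1.1.2 + 1) :=
    computable_sumCode (hz.comp Computable.fst) ha hn'
  have hja : Computable fun y : (((ℕ × ℕ) × ℕ) × ℕ) × ℕ => seqOf y.1.1.1.1 y.2 :=
    computable_seqOf.comp (hj.comp Computable.fst) ha
  have hpow : Computable fun y : (((ℕ × ℕ) × ℕ) × ℕ) × ℕ => dyadicCode 1 (y.1.1.1.2 + 1) :=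
    computable_dyadicCode.comp (Computable.const 1) (Computable.succ.comp (hl.comp Computable.fst))
  have hup : Computable fun y : (((ℕ × ℕ) × ℕ) × ℕ) × ℕ => nsmulCode (y.1.1.2 + 1)
      (addCode (seqOf y.1.1.1.1 y.2) (dyadicCode 1 (y.1.1.1.2 + 1))) :=
    computable_nsmulCode.comp hn' (computable_addCode.comp hja hpow)
  have hmid : Computable fun y : (((ℕ × ℕ) × ℕ) × ℕ) × ℕ =>
      nsmulCode (y.1.1.2 + 1) (seqOf y.1.1.1.1 y.2) := computable_nsmulCode.comp hn' hja
  have hlow : Computable fun y : (((ℕ × ℕ) × ℕ) × ℕ) × ℕ =>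
      addCode (sumCode y.1.2 y.2 (y.1.1.2 + 1))
        (nsmulCode (y.1.1.2 + 1) (dyadicCode 1 (y.1.1.1.2 + 1))) :=
    computable_addCode.comp hsum (computable_nsmulCode.comp hn' hpow)
  have h2 := rePred_ratOfCode_lt.comp (hsum.pair hup)
  have h3 := rePred_ratOfCode_lt.comp (hmid.pair hlow)
  have h4 := (h2.and h3).forall_lt (Computable.const m)
  refine ((h1.and h4).exists_nat.exists_nat).of_eq fun p => ?_
  simp only [ApproximatesAverage]

theorem approximatesAverage_iff {j l : ℕ} : ApproximatesAverage X cf cg φ m j l ↔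
    ∃ n z, ApproximatesOrbit X cf cg φ (n + 1) z (l + 2) ∧ ∀ a : Fin m,
      |((n + 1 : ℕ) : ℝ)⁻¹ * ∑ t ∈ Finset.range (n + 1),
        (seq (seqOf z t) : EuclideanSpace ℝ (Fin m)) a -
        (seq j : EuclideanSpace ℝ (Fin m)) a| < (2 : ℝ)⁻¹ ^ (l + 1) := by
  refine exists_congr fun n => exists_congr fun z => and_congr Iff.rfl ?_
  have key : ∀ a : ℕ,
      (ratOfCode (sumCode z a (n + 1)) <
        ratOfCode (nsmulCode (n + 1) (addCode (seqOf j a) (dyadicCode 1 (l + 1)))) ∧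
      ratOfCode (nsmulCode (n + 1) (seqOf j a)) <
        ratOfCode (addCode (sumCode z a (n + 1)) (nsmulCode (n + 1) (dyadicCode 1 (l + 1))))) ↔
      |((n + 1 : ℕ) : ℝ)⁻¹ * ∑ t ∈ Finset.range (n + 1), (ratOfCode (seqOf (seqOf z t) a) : ℝ) -
        ratOfCode (seqOf j a)| < (2 : ℝ)⁻¹ ^ (l + 1) := by
    intro a
    rw [← Rat.cast_lt (K := ℝ), ← Rat.cast_lt (K := ℝ)]
    simp only [ratOfCode_nsmulCode, ratOfCode_addCode, Rat.cast_mul, Rat.cast_add,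
      ratOfCode_dyadicCode, Rat.cast_natCast, ratOfCode_sumCode, Rat.cast_sum]
    set S := ∑ t ∈ Finset.range (n + 1), (ratOfCode (seqOf (seqOf z t) a) : ℝ)
    have hn : (0 : ℝ) < ((n + 1 : ℕ) : ℝ) := by positivity
    -- The certificate is multiplied through by `n + 1`, since codes are not divided; here the
    -- division is restored.
    rw [abs_lt, sub_lt_iff_lt_add, inv_mul_lt_iff₀ hn, lt_sub_iff_add_lt, lt_inv_mul_iff₀ hn]
    simp only [Nat.cast_one, one_mul]
    constructor <;> rintro ⟨h1, h2⟩ <;> constructor <;> linarith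
  simp only [key, seq_euclidean_apply]
  exact ⟨fun h a => h a a.2, fun h a ha => h ⟨a, ha⟩⟩

/-- A semidecidable certificate that, up to `2⁻ˡ`, all points obtained from the point coded by `j`
by adding `d l` to one coordinate are averages along orbits. -/
def ApproximatesShifts (X : Type*) [MetricSpace X] [ComputableMetricSpace X] (cf cg : OracleCode)
    (φ : ℕ → ℕ → List ℕ) (m : ℕ) (d : ℕ → ℕ) (j l : ℕ) : Prop :=
  ∃ z, ∀ i < m, ApproximatesAverage X cf cg φ m (seqOf z i) l ∧ ∀ a < m,
    seqOf (seqOf z i) a = addCode (seqOf j a) (if a = i then d l else 0)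

theorem rePred_approximatesShifts (hd : HasComputableMetric X) (cf cg : OracleCode)
    (hφ : Computable₂ φ) (m : ℕ) {d : ℕ → ℕ} (hc : Computable d) :
    REPred fun p : ℕ × ℕ => ApproximatesShifts X cf cg φ m d p.1 p.2 := by
  have hl : Computable fun x : ((ℕ × ℕ) × ℕ) × ℕ => x.1.1.2 :=
    Computable.snd.comp (Computable.fst.comp Computable.fst)
  have hj : Computable fun x : ((ℕ × ℕ) × ℕ) × ℕ => x.1.1.1 :=
    Computable.fst.comp (Computable.fst.comp Computable.fst)
  have hi : Computable fun x : ((ℕ × ℕ) × ℕ) × ℕ => x.2 := Computable.snd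
  have hz : Computable fun x : ((ℕ × ℕ) × ℕ) × ℕ => seqOf x.1.2 x.2 :=
    computable_seqOf.comp (Computable.snd.comp Computable.fst) hi
  have h1 : REPred fun x : ((ℕ × ℕ) × ℕ) × ℕ =>
      ApproximatesAverage X cf cg φ m (seqOf x.1.2 x.2) x.1.1.2 :=
    (rePred_approximatesAverage hd cf cg hφ m).comp
      (f := fun x : ((ℕ × ℕ) × ℕ) × ℕ => (seqOf x.1.2 x.2, x.1.1.2)) (hz.pair hl)
  have ha : Computable fun y : (((ℕ × ℕ) × ℕ) × ℕ) × ℕ => y.2 := Computable.snd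
  have hleft : Computable fun y : (((ℕ × ℕ) × ℕ) × ℕ) × ℕ => seqOf (seqOf y.1.1.2 y.1.2) y.2 :=
    computable_seqOf.comp (hz.comp Computable.fst) ha
  have hif : Computable fun y : (((ℕ × ℕ) × ℕ) × ℕ) × ℕ =>
      if y.2 = y.1.2 then d y.1.1.1.2 else 0 := by
    refine (Computable.cond (Primrec.eq.decide.to_comp.comp ha (hi.comp Computable.fst))
      (hc.comp (hl.comp Computable.fst)) (Computable.const 0)).of_eq fun y => ?_
    rw [Bool.cond_decide]
  have hright : Computable fun y : (((ℕ × ℕ) × ℕ) × ℕ) × ℕ =>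
      addCode (seqOf y.1.1.1.1 y.2) (if y.2 = y.1.2 then d y.1.1.1.2 else 0) :=
    computable_addCode.comp (computable_seqOf.comp (hj.comp Computable.fst) ha) hif
  have h2 : REPred fun y : (((ℕ × ℕ) × ℕ) × ℕ) × ℕ => seqOf (seqOf y.1.1.2 y.1.2) y.2 =
      addCode (seqOf y.1.1.1.1 y.2) (if y.2 = y.1.2 then d y.1.1.1.2 else 0) :=
    (Computable.computablePred (Primrec.eq.decide.to_comp.comp hleft hright)).to_re
  exact ((h1.and (h2.forall_lt (Computable.const m))).forall_lt (Computable.const m)).exists_nat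

theorem ApproximatesShifts.exists_approximatesAverage {d : ℕ → ℕ} {j l : ℕ}
    (h : ApproximatesShifts X cf cg φ m d j l) (i : Fin m) :
    ∃ k, ApproximatesAverage X cf cg φ m k l ∧ ∀ a : Fin m,
      (seq k : EuclideanSpace ℝ (Fin m)) a =
        (seq j : EuclideanSpace ℝ (Fin m)) a + if a = i then (ratOfCode (d l) : ℝ) else 0 := by
  obtain ⟨z, hz⟩ := h
  refine ⟨_, (hz i i.2).1, fun a => ?_⟩
  rw [seq_euclidean_apply, seq_euclidean_apply, (hz i i.2).2 a a.2, ratOfCode_addCode, Rat.cast_add]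
  congr 1
  by_cases h : a = i
  · simp [h]
  · simp [h, Fin.val_inj, ratOfCode_zero]

/-- The certificate fixes codes of the shifted coordinates, not only their values, so the hypothesis
covers all `k` with these values. Coordinates that are not shifted get the code `0` added, which
codes the rational `0`. -/
theorem approximatesShifts_of_forall {d : ℕ → ℕ} {j l : ℕ}
    (h : ∀ k (i : Fin m), (∀ a : Fin m, (seq k : EuclideanSpace ℝ (Fin m)) a =
      (seq j : EuclideanSpace ℝ (Fin m)) a + if a = i then (ratOfCode (d l) : ℝ) else 0) →
      ApproximatesAverage X cf cg φ m k l) : ApproximatesShifts X cf cg φ m d j l := by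
  choose k hk using fun i : ℕ =>
    exists_seqOf (fun a => addCode (seqOf j a) (if a = i then d l else 0)) m
  obtain ⟨z, hz⟩ := exists_seqOf k m
  refine ⟨z, fun i hi => ?_⟩
  rw [hz i hi]
  refine ⟨h _ ⟨i, hi⟩ fun a => ?_, fun a ha => hk i a ha⟩
  rw [seq_euclidean_apply, seq_euclidean_apply, hk i a a.2, ratOfCode_addCode, Rat.cast_add]
  congr 1
  by_cases h : (a : ℕ) = i
  · simp [h, Fin.ext_iff]
  · simp [h, Fin.ext_iff, ratOfCode_zero]

end Averages

end ComputableMetricSpace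

/-! ### Periodic orbit measures and convexity of the rotation set -/

namespace RotationSet

section Measures

variable {X : Type*} [MetricSpace X] [CompactSpace X] [MeasurableSpace X] [BorelSpace X] {f : X → X}
  {m : ℕ} {Φ : X → EuclideanSpace ℝ (Fin m)}

theorem orbitMeasure_apply (f : X → X) (x : X) (s : Set X) : orbitMeasure f x s =
    (Function.minimalPeriod f x : ENNReal)⁻¹ *
      ∑ i ∈ Finset.range (Function.minimalPeriod f x), Measure.dirac (f^[i] x) s := by
  simp [orbitMeasure]

theorem isProbabilityMeasure_orbitMeasure {x : X} (hx : x ∈ Function.periodicPts f) :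
    IsProbabilityMeasure (orbitMeasure f x) := by
  refine ⟨?_⟩
  have h := Function.minimalPeriod_pos_of_mem_periodicPts hx
  rw [orbitMeasure_apply]
  simp only [measure_univ, Finset.sum_const, Finset.card_range, nsmul_eq_mul, mul_one]
  exact ENNReal.inv_mul_cancel (by exact_mod_cast h.ne') (ENNReal.natCast_ne_top _)

/-- Pushing forward shifts the orbit sum by one index. The terms gained and lost agree because the
orbit returns to `x`, and the common term is finite, hence cancels in `ENNReal`. -/
theorem measurePreserving_orbitMeasure (hf : Measurable f) (x : X) :
    MeasurePreserving f (orbitMeasure f x) (orbitMeasure f x) := by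
  refine ⟨hf, Measure.ext fun s hs => ?_⟩
  rw [Measure.map_apply hf hs, orbitMeasure_apply, orbitMeasure_apply]
  congr 1
  have h1 : ∀ i, Measure.dirac (f^[i] x) (f ⁻¹' s) = Measure.dirac (f^[i + 1] x) s := by
    intro i
    rw [Measure.dirac_apply' _ (hf hs), Measure.dirac_apply' _ hs, Function.iterate_succ_apply']
    rfl
  simp only [h1]
  have h2 := Finset.sum_range_succ (fun i => Measure.dirac (f^[i] x) s)
    (Function.minimalPeriod f x)
  rw [Finset.sum_range_succ', Function.iterate_minimalPeriod] at h2
  refine (ENNReal.add_left_inj ?_).1 h2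
  exact ((measure_mono (Set.subset_univ s)).trans_lt (by simp)).ne

theorem integral_orbitMeasure (f : X → X) (x : X) (g : X → ℝ) : ∫ y, g y ∂(orbitMeasure f x) =
    (Function.minimalPeriod f x : ℝ)⁻¹ *
      ∑ i ∈ Finset.range (Function.minimalPeriod f x), g (f^[i] x) := by
  rw [orbitMeasure, integral_smul_measure, integral_finsetSum_measure]
  · simp
  · exact fun i _ => integrable_dirac (by simp)

theorem rotationVector_apply {Z : Type*} [MeasurableSpace Z]
    {Φ : Z → EuclideanSpace ℝ (Fin m)} (μ : ProbabilityMeasure Z) (a : Fin m) :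
    rotationVector Φ μ a = ∫ x, Φ x a ∂(μ : Measure Z) := rfl

theorem continuous_coord {Z : Type*} [TopologicalSpace Z] {Φ : Z → EuclideanSpace ℝ (Fin m)}
    (hΦ : Continuous Φ) (a : Fin m) : Continuous fun x => Φ x a :=
  (EuclideanSpace.proj a).continuous.comp hΦ

theorem integrable_coord (hΦ : Continuous Φ) (a : Fin m) (μ : Measure X) [IsFiniteMeasure μ] :
    Integrable (fun x => Φ x a) μ :=
  (continuous_coord hΦ a).integrable_of_hasCompactSupport (HasCompactSupport.of_compactSpace _)

theorem exists_mem_rot_of_mem_periodicPts (hf : Measurable f) {x : X}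
    (hx : x ∈ Function.periodicPts f) : ∃ v ∈ rot f Φ, ∀ a, v a =
      (Function.minimalPeriod f x : ℝ)⁻¹ *
        ∑ t ∈ Finset.range (Function.minimalPeriod f x), Φ (f^[t] x) a :=
  ⟨_, ⟨⟨orbitMeasure f x, isProbabilityMeasure_orbitMeasure hx⟩,
    measurePreserving_orbitMeasure hf x, rfl⟩, fun a => integral_orbitMeasure f x fun y => Φ y a⟩

theorem convex_rot (hΦ : Continuous Φ) : Convex ℝ (rot f Φ) := by
  rintro _ ⟨μ, hμ, rfl⟩ _ ⟨ν, hν, rfl⟩ a b ha hb hab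
  have hp : IsProbabilityMeasure (ENNReal.ofReal a • (μ : Measure X) +
      ENNReal.ofReal b • (ν : Measure X)) := by
    refine ⟨?_⟩
    simp [← ENNReal.ofReal_add ha hb, hab]
  refine ⟨⟨_, hp⟩, ⟨hμ.measurable, ?_⟩, ?_⟩
  · change Measure.map f (ENNReal.ofReal a • (μ : Measure X) +
      ENNReal.ofReal b • (ν : Measure X)) = _
    rw [Measure.map_add _ _ hμ.measurable, Measure.map_smul, Measure.map_smul, hμ.map_eq, hν.map_eq]
    rfl
  · ext i
    simp only [PiLp.add_apply, PiLp.smul_apply, smul_eq_mul, rotationVector_apply]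
    change ∫ x, Φ x i ∂(ENNReal.ofReal a • (μ : Measure X) + ENNReal.ofReal b • (ν : Measure X)) = _
    rw [integral_add_measure, integral_smul_measure, integral_smul_measure,
      ENNReal.toReal_ofReal ha, ENNReal.toReal_ofReal hb, smul_eq_mul, smul_eq_mul]
    · exact (integrable_coord hΦ i _).smul_measure ENNReal.ofReal_ne_top
    · exact (integrable_coord hΦ i _).smul_measure ENNReal.ofReal_ne_top

/-- Coordinates of `Φ` are bounded continuous functions by compactness, so closeness of the finitely
many integrals is a weak* open condition, met by some periodic measure. -/
theorem exists_periodic_near_of_mem_rot (hΦ : Continuous Φ)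
    (hdense : invariantMeasures f ⊆ closure (periodicPointMeasures f)) {v} (hv : v ∈ rot f Φ)
    {ε : ℝ} (hε : 0 < ε) : ∃ x ∈ Function.periodicPts f, ∀ a,
      |(Function.minimalPeriod f x : ℝ)⁻¹ *
        ∑ t ∈ Finset.range (Function.minimalPeriod f x), Φ (f^[t] x) a - v a| < ε := by
  obtain ⟨μ, hμ, rfl⟩ := hv
  have hopen : IsOpen {ν : ProbabilityMeasure X |
      ∀ a, |rotationVector Φ ν a - rotationVector Φ μ a| < ε} := by
    rw [Set.ofPred_forall]
    refine isOpen_iInter_of_finite fun a => isOpen_lt ?_ continuous_const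
    have := ProbabilityMeasure.continuous_integral_boundedContinuousFunction
      (BoundedContinuousFunction.mkOfCompact ⟨fun x => Φ x a, continuous_coord hΦ a⟩)
    exact (this.sub continuous_const).abs
  obtain ⟨ν, hν, x, hx, hνx⟩ := mem_closure_iff.1 (hdense hμ) _ hopen fun a => by simpa using hε
  refine ⟨x, hx, fun a => ?_⟩
  have := hν a
  rwa [rotationVector_apply, hνx, integral_orbitMeasure] at this

end Measures

/-! ### Balls inside convex sets from approximate cross-polytopes -/

section Convexity

variable {m : ℕ}

theorem abs_apply_le_dist (v w : EuclideanSpace ℝ (Fin m)) (a : Fin m) :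
    |v a - w a| ≤ dist v w := by
  rw [dist_eq_norm]
  exact PiLp.norm_apply_le (v - w) a

/-- A convex set that contains points close to the vertices of a cross-polytope contains a ball. -/
theorem ball_subset_of_convex {S : Set (EuclideanSpace ℝ (Fin m))} (hS : Convex ℝ S)
    (hne : S.Nonempty) {c : EuclideanSpace ℝ (Fin m)} {ρ : ℝ}
    (hplus : ∀ i, ∃ v ∈ S, ∀ a, |v a - (c a + if a = i then 4 * (m + 1) * ρ else 0)| < ρ)
    (hminus : ∀ i, ∃ v ∈ S, ∀ a, |v a - (c a + if a = i then -(4 * (m + 1) * ρ) else 0)| < ρ) :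
    Metric.ball c (2 * ρ) ⊆ S := by
  intro y hy
  have hρ : 0 < ρ := by
    have := dist_nonneg.trans_lt hy
    linarith
  obtain ⟨w, hw⟩ := hne
  choose p hp hp' using hplus
  choose q hq hq' using hminus
  -- `S` need not be closed, so separation is applied to the convex hull of finitely many of its
  -- points. Including `w` keeps the hull nonempty when `m = 0`, and then `u w < u y` excludes that
  -- case.
  set F : Set (EuclideanSpace ℝ (Fin m)) := insert w (Set.range p ∪ Set.range q) with hF
  have hFS : convexHull ℝ F ⊆ S := by
    refine convexHull_min ?_ hS
    rw [hF, Set.insert_subset_iff, Set.union_subset_iff, Set.range_subset_iff, Set.range_subset_iff]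
    exact ⟨hw, hp, hq⟩
  have hFfin : F.Finite := ((Set.finite_range p).union (Set.finite_range q)).insert w
  by_contra hyS
  have hclosed : IsClosed (convexHull ℝ F) := (hFfin.isCompact_convexHull (𝕜 := ℝ)).isClosed
  obtain ⟨u, s, hu, hus⟩ := geometric_hahn_banach_closed_point (convex_convexHull ℝ F)
    hclosed fun h => hyS (hFS h)
  have hlt : ∀ v ∈ F, u v < u y := fun v hv => (hu v (subset_convexHull ℝ F hv)).trans hus
  set b : Fin m → ℝ := fun a => u (EuclideanSpace.single a 1) with hb
  have hsum : ∀ v : EuclideanSpace ℝ (Fin m), u v = ∑ a, v a * b a := by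
    intro v
    conv_lhs => rw [← (EuclideanSpace.basisFun (Fin m) ℝ).sum_repr v]
    simp [hb]
  have hw' := hlt w (Set.mem_insert _ _)
  rcases isEmpty_or_nonempty (Fin m) with hm | hm
  · simp [hsum] at hw'
  -- The vertices used lie along the axis where the separating functional has its largest
  -- coefficient, so that coefficient bounds all error terms.
  obtain ⟨i, hi⟩ := Finite.exists_max fun a => |b a|
  have hpos : 0 < |b i| := by
    by_contra h
    have h0 : ∀ a, b a = 0 := fun a => abs_nonpos_iff.1 ((hi a).trans (not_lt.1 h))
    simp [hsum, h0] at hw'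
  -- Apart from the shift `δ`, each coordinate of `v - y` is at most `3ρ` in size: `ρ` from the
  -- vertex and `2ρ` from `y`. Since `u v < u y`, the gain `δ * b i` cannot exceed the total error.
  have key : ∀ v δ, (∀ a, |v a - (c a + if a = i then δ else 0)| < ρ) → v ∈ F →
      δ * b i ≤ m * (3 * ρ * |b i|) := by
    intro v δ hv hvF
    have h1 : u v - u y = δ * b i +
        ∑ a, (v a - (c a + if a = i then δ else 0) + (c a - y a)) * b a := by
      have : δ * b i = ∑ a, (if a = i then δ else 0) * b a := by simp
      rw [this, hsum, hsum, ← Finset.sum_sub_distrib, ← Finset.sum_add_distrib]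
      exact Finset.sum_congr rfl fun a _ => by ring
    have h2 : |∑ a, (v a - (c a + if a = i then δ else 0) + (c a - y a)) * b a| ≤
        ∑ _a : Fin m, 3 * ρ * |b i| := by
      refine (Finset.abs_sum_le_sum_abs _ _).trans (Finset.sum_le_sum fun a _ => ?_)
      rw [abs_mul]
      refine mul_le_mul ((abs_add_le _ _).trans ?_) (hi a) (abs_nonneg _) (by positivity)
      have h3 := abs_apply_le_dist c y a
      rw [dist_comm] at h3
      have h4 := hv a
      have h5 := Metric.mem_ball.1 hy
      linarith
    rw [Finset.sum_const, Finset.card_univ, Fintype.card_fin, nsmul_eq_mul] at h2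
    have h6 := hlt v hvF
    have h7 := (abs_le.1 h2).1
    linarith
  have hbound : m * (3 * ρ * |b i|) < 4 * (m + 1) * ρ * |b i| := by
    have : 0 < ρ * |b i| := by positivity
    nlinarith [Nat.cast_nonneg (α := ℝ) m]
  -- The sign of `b i` selects the vertex at which the gain is `4(m+1)ρ|b i|`, too large for the
  -- bound.
  rcases abs_cases (b i) with ⟨h, -⟩ | ⟨h, -⟩
  · have := key (p i) _ (hp' i) (by simp [hF])
    rw [h] at this hbound
    linarith
  · have := key (q i) _ (hq' i) (by simp [hF])
    rw [h] at this hbound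
    linarith

end Convexity

end RotationSet

theorem abs_average_sub_average_lt {n : ℕ} (hn : 1 ≤ n) {x y : ℕ → ℝ} {ε : ℝ}
    (h : ∀ t < n, |x t - y t| < ε) :
    |(n : ℝ)⁻¹ * ∑ t ∈ Finset.range n, x t - (n : ℝ)⁻¹ * ∑ t ∈ Finset.range n, y t| < ε := by
  have hn' : (0 : ℝ) < n := by exact_mod_cast hn
  rw [← mul_sub, ← Finset.sum_sub_distrib, abs_mul, abs_of_pos (inv_pos.2 hn'), inv_mul_lt_iff₀ hn']
  refine (Finset.abs_sum_le_sum_abs _ _).trans_lt ((Finset.sum_lt_sum_of_nonempty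
    (Finset.nonempty_range_iff.2 (by omega)) fun t ht => h t (Finset.mem_range.1 ht)).trans_eq ?_)
  simp

/-! ### Soundness and completeness of the certificates -/

namespace RotationSet

open ComputableMetricSpace

variable {X : Type*} [MetricSpace X] [CompactSpace X] [MeasurableSpace X] [BorelSpace X]
  [ComputableMetricSpace X] {f : X → X} {m : ℕ} {Φ : X → EuclideanSpace ℝ (Fin m)}
  {cf cg : OracleCode} {φ : ℕ → ℕ → List ℕ}

/-- The orbit values contribute an error below `2⁻⁽ˡ⁺²⁾` and the comparison of averages one below
`2⁻⁽ˡ⁺¹⁾`; together they stay below `2⁻ˡ`. -/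
theorem exists_mem_rot_of_approximatesAverage (hf : Computes cf f) (hΦ : Computes cg Φ)
    (hφ : ApproximatesSets φ (Per f)) {j l : ℕ} (h : ApproximatesAverage X cf cg φ m j l) :
    ∃ v ∈ rot f Φ, ∀ a, |v a - (seq j : EuclideanSpace ℝ (Fin m)) a| < (2 : ℝ)⁻¹ ^ l := by
  obtain ⟨n, z, hz, hza⟩ := approximatesAverage_iff.1 h
  obtain ⟨x, ⟨hx, hxn⟩, hdist⟩ := hz.exists_mem hf hΦ hφ (by omega)
  obtain ⟨v, hv, hva⟩ := exists_mem_rot_of_mem_periodicPts (Φ := Φ) hf.continuous.measurable hx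
  refine ⟨v, hv, fun a => ?_⟩
  have h1 := abs_average_sub_average_lt (n := n + 1) (by omega) fun t ht =>
    (abs_apply_le_dist _ _ a).trans_lt (hdist t ht)
  rw [hva, hxn]
  have h2 := hza a
  rw [abs_lt] at h1 h2 ⊢
  have h3 : (0 : ℝ) < (2 : ℝ)⁻¹ ^ l := by positivity
  rw [pow_add] at h1 h2
  norm_num only at h1 h2 h3 ⊢
  constructor <;> linarith

/-- Density and the approximation of the orbit values each cost less than `2⁻⁽ˡ⁺²⁾`, which fits the
tolerance `2⁻⁽ˡ⁺¹⁾` of the certificate. -/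
theorem approximatesAverage_of_mem_rot (hf : Computes cf f) (hΦ : Computes cg Φ)
    (hφ : ApproximatesSets φ (Per f))
    (hdense : invariantMeasures f ⊆ closure (periodicPointMeasures f)) {j l : ℕ}
    (h : (seq j : EuclideanSpace ℝ (Fin m)) ∈ rot f Φ) : ApproximatesAverage X cf cg φ m j l := by
  obtain ⟨x, hx, hxa⟩ := exists_periodic_near_of_mem_rot hΦ.continuous hdense h
    (ε := (2 : ℝ)⁻¹ ^ (l + 2)) (by positivity)
  have hn := Function.minimalPeriod_pos_of_mem_periodicPts hx
  obtain ⟨n, hxn⟩ : ∃ n, Function.minimalPeriod f x = n + 1 := ⟨_, (Nat.succ_pred hn.ne').symm⟩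
  obtain ⟨z, hz, hdist⟩ := exists_approximatesOrbit hf hΦ hφ (n := n + 1) (by omega)
    ⟨hx, hxn⟩ (l + 2)
  refine approximatesAverage_iff.2 ⟨n, z, hz, fun a => ?_⟩
  have h1 := abs_average_sub_average_lt (n := n + 1) (by omega) fun t ht =>
    (abs_apply_le_dist _ _ a).trans_lt (hdist t ht)
  have h2 := hxa a
  rw [hxn] at h2
  rw [abs_lt] at h1 h2 ⊢
  rw [pow_add] at h1 h2 ⊢
  norm_num only at h1 h2 ⊢
  constructor <;> linarith

/-- Shifts of a member of the dense sequence close to `w` stay in a neighbourhood of `w`. -/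
theorem approximatesShifts_of_ball_subset (hf : Computes cf f) (hΦ : Computes cg Φ)
    (hφ : ApproximatesSets φ (Per f))
    (hdense : invariantMeasures f ⊆ closure (periodicPointMeasures f)) {j l : ℕ} {d : ℕ → ℕ}
    {w : EuclideanSpace ℝ (Fin m)} {r : ℝ}
    (hr : dist w (seq j) + |(ratOfCode (d l) : ℝ)| < r) (hw : Metric.ball w r ⊆ rot f Φ) :
    ApproximatesShifts X cf cg φ m d j l := by
  refine approximatesShifts_of_forall fun k i hk =>
    approximatesAverage_of_mem_rot hf hΦ hφ hdense (hw ?_)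
  have h : (seq k : EuclideanSpace ℝ (Fin m)) =
      seq j + PiLp.single 2 i (ratOfCode (d l) : ℝ) := by
    ext a
    rw [hk, PiLp.add_apply, PiLp.single_apply]
  have h1 : dist (seq j : EuclideanSpace ℝ (Fin m)) (seq k) = |(ratOfCode (d l) : ℝ)| := by
    rw [h, dist_self_add_right, PiLp.norm_single, Real.norm_eq_abs]
  rw [Metric.mem_ball']
  exact (dist_triangle _ _ _).trans_lt (by rwa [h1])

end RotationSet

theorem mainTheorem10 {X : Type*} [MetricSpace X] [CompactSpace X] [MeasurableSpace X]
    [BorelSpace X] [ComputableMetricSpace X]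
    (hd : ComputableMetricSpace.HasComputableMetric X)
    (f : X → X) (hf : ComputableMetricSpace.IsComputableMap f)
    (hdense : RotationSet.invariantMeasures f ⊆ closure (RotationSet.periodicPointMeasures f))
    (hper : RotationSet.PeriodicPointsUniformlyComputable f)
    {m : ℕ} (Φ : X → EuclideanSpace ℝ (Fin m)) (hΦ : ComputableMetricSpace.IsComputableMap Φ) :
    ∃ c : OracleCode, ∀ w₀ ∈ interior (RotationSet.rot f Φ), ∀ ψ : ℕ → ℕ,
      ComputableMetricSpace.IsOracle ψ w₀ →
        ∃ k ∈ c.eval ψ 0, 0 < ratOfCode k ∧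
          Metric.ball w₀ (ratOfCode k : ℝ) ⊆ interior (RotationSet.rot f Φ) := by
  obtain ⟨cf, hcf⟩ := hf
  obtain ⟨cg, hcg⟩ := hΦ
  obtain ⟨φ, hφc, hφ⟩ := hper
  replace hcf : ComputableMetricSpace.Computes cf f := hcf
  replace hcg : ComputableMetricSpace.Computes cg Φ := hcg
  replace hφ : ComputableMetricSpace.ApproximatesSets φ (RotationSet.Per f) := fun n k => hφ n k
  have hplus : Computable (dyadicCode (4 * (m + 1))) :=
    computable_dyadicCode.comp (Computable.const _) Computable.id
  have hminus : Computable (negDyadicCode (4 * (m + 1))) :=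
    computable_negDyadicCode.comp (Computable.const _) Computable.id
  obtain ⟨q, hq, hqp⟩ := rePred_iff_exists_computable.1
    ((ComputableMetricSpace.rePred_approximatesShifts hd cf cg hφc m hplus).and
      (ComputableMetricSpace.rePred_approximatesShifts hd cf cg hφc m hminus))
  have hu : Computable fun z : ℕ => z.unpair.1 := Computable.fst.comp Computable.unpair
  -- The search variable `z` codes a precision `l`, which is the oracle query, and a step count for
  -- the semidecision procedure.
  have hq' : Computable₂ fun j z : ℕ => q (j, z.unpair.1) z.unpair.2 :=
    hq.comp (Computable.fst.pair (hu.comp Computable.snd))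
      (Computable.snd.comp (Computable.unpair.comp Computable.snd))
  obtain ⟨c, hc⟩ := OracleCode.exists_search hq' hu
    (computable_dyadicCode.comp (Computable.const 1) hu)
  refine ⟨c, fun w₀ hw₀ ψ hψ => ?_⟩
  have hex : ∃ z : ℕ, q (ψ z.unpair.1, z.unpair.1) z.unpair.2 = true := by
    obtain ⟨ε, hε, hball⟩ := Metric.mem_nhds_iff.1 (mem_interior_iff_mem_nhds.1 hw₀)
    -- The oracle error `2⁻ˡ` and the shift `4(m+1)2⁻ˡ` together must stay below `ε`.
    obtain ⟨l, hl⟩ := ComputableMetricSpace.exists_pow_lt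
      (ε := ε / (4 * (m + 1) + 1)) (by positivity)
    have hl' := hl l le_rfl
    rw [lt_div_iff₀ (by positivity)] at hl'
    have hbound : dist w₀ (ComputableMetricSpace.seq (ψ l)) + 4 * (m + 1) * (2 : ℝ)⁻¹ ^ l < ε := by
      linarith [hψ l]
    have hval : |4 * ((m : ℝ) + 1) * (2 : ℝ)⁻¹ ^ l| = 4 * (m + 1) * (2 : ℝ)⁻¹ ^ l :=
      abs_of_nonneg (by positivity)
    obtain ⟨n, hn⟩ := (hqp (ψ l, l)).1
      ⟨RotationSet.approximatesShifts_of_ball_subset hcf hcg hφ hdense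
        (by rw [ratOfCode_dyadicCode]; push_cast; rwa [hval]) hball,
      RotationSet.approximatesShifts_of_ball_subset hcf hcg hφ hdense
        (by rw [ratOfCode_negDyadicCode, abs_neg]; push_cast; rwa [hval]) hball⟩
    exact ⟨Nat.pair l n, by simpa using hn⟩
  obtain ⟨z, hz, hmem⟩ := hc ψ hex
  refine ⟨_, hmem, ?_, ?_⟩
  · rw [← Rat.cast_pos (K := ℝ), ratOfCode_dyadicCode]
    positivity
  rw [ratOfCode_dyadicCode, Nat.cast_one, one_mul]
  -- The rational centre is within `2⁻ˡ` of `w₀`, so a ball of twice the output radius about it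
  -- suffices.
  refine interior_maximal (subset_trans ?_ (RotationSet.ball_subset_of_convex
    (RotationSet.convex_rot hcg.continuous) ⟨w₀, interior_subset hw₀⟩
    (c := ComputableMetricSpace.seq (ψ z.unpair.1)) (ρ := (2 : ℝ)⁻¹ ^ z.unpair.1) ?_ ?_))
    Metric.isOpen_ball
  · refine Metric.ball_subset_ball' ?_
    linarith [hψ z.unpair.1]
  · intro i
    obtain ⟨k, hk, hka⟩ := ((hqp _).2 ⟨_, hz⟩).1.exists_approximatesAverage i
    obtain ⟨v, hv, hva⟩ := RotationSet.exists_mem_rot_of_approximatesAverage hcf hcg hφ hk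
    refine ⟨v, hv, fun a => ?_⟩
    have := hva a
    rw [hka, ratOfCode_dyadicCode] at this
    exact_mod_cast this
  · intro i
    obtain ⟨k, hk, hka⟩ := ((hqp _).2 ⟨_, hz⟩).2.exists_approximatesAverage i
    obtain ⟨v, hv, hva⟩ := RotationSet.exists_mem_rot_of_approximatesAverage hcf hcg hφ hk
    refine ⟨v, hv, fun a => ?_⟩
    have := hva a
    rw [hka, ratOfCode_negDyadicCode] at this
    exact_mod_cast this
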